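/- Let $\mathbb{D}=\{z\in\mathbb{C}:|z|<1\}$ be the Poincaré disk, $\mathbb{S}^1=\partial\mathbb{D}$, and $\Delta=\frac14(1-|z|^2)^2\left(\partial_x^2+\partial_y^2\right)$. Let $s=\frac12+it$ with $t\in\mathbb{R}$, and let $f:\mathbb{D}\to\mathbb{R}$ be a bounded $\mathcal{C}^2$ function with $\Delta f=-s(1-s)f$. For an interval (connected subset) $I\subset\mathbb{S}^1$ and a function $\psi$ that is $\mathcal{C}^1$ on the closure of $I$, the Helgason distribution $\mathcal{D}_{f,s}$ is tested on $\psi\mathbf{1}_I$ by $$\langle\mathcal{D}_{f,s},\psi\mathbf{1}_I\rangle=\lim_{r\to+\infty}\frac1{c(s)}\int_{\{\theta\in(0,2\pi]:\,e^{i\theta}\in I\}}\Psi\left(z_r(\theta)\right)e^{-sr}\left(\frac{\partial}{\partial r}\left[f(z_r(\theta))\right]+s\,f(z_r(\theta))\right)\sinh(r)\,d\theta,\qquad z_r(\theta)=\tanh\left(\tfrac r2\right)e^{i\theta},$$ where $\Psi$ is any $\mathcal{C}^1$ extension of $\psi|_I$ to a neighbourhood of $\mathbb{S}^1$, and $c(s)=2\sqrt{\pi}\,\Gamma(s+\frac12)/\Gamma(s)$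 is the nonzero constant for which $\langle\mathcal{D}_{f,s},\mathbf{1}\rangle=f(0)$. Proposition. Let $\gamma$ be an orientation-preserving isometry of $\mathbb{D}$, that is, $\gamma(z)=\frac{az+b}{\bar bz+\bar a}$ with $|a|^2-|b|^2=1$ (for instance, any element of a co-compact Fuchsian group $\Gamma$), such that $f\circ\gamma=f$ on $\mathbb{D}$; $f$ need not be invariant under any other isometry. Let $I\subset\mathbb{S}^1$ be an interval and $\psi:\overline{I}\to\mathbb{C}$ a function that is $\mathcal{C}^1$ on the closure of $I$. Then $\psi|_I$ and $\left.\frac{\psi\circ\gamma^{-1}}{|\gamma'\circ\gamma^{-1}|^{s}}\right|_{\gamma(I)}$ have $\mathcal{C}^1$ extensions to neighbourhoods of $\mathbb{S}^1$, both limits below exist and do not depend on the choice of these extensions, and $$\left\langle\mathcal{D}_{f,s},\ \frac{\psi\circ\gamma^{-1}}{|\gamma'\circ\gamma^{-1}|^{s}}\,\mathbf{1}_{\gamma(I)}\right\rangle=\left\langle\mathcal{D}_{f,s},\ \psi\,\mathbf{1}_I\right\rangle .$$ -/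

import Mathlib

open scoped Laplacian

namespace Helgason

/-- The open unit disk, as a subset of `ℂ`. -/
def disk : Set ℂ := Metric.ball 0 1

/-- The circle at infinity, as a subset of `ℂ`. -/
def circle : Set ℂ := Metric.sphere 0 1

/-- An orientation preserving isometry of the Poincaré disk, given by the entries of a matrix of
`SU(1,1)`. The elements of a Fuchsian group acting on the disk are of this form. -/
structure DiskMobius where
  a : ℂ
  b : ℂ
  norm_sq_sub : ‖a‖ ^ 2 - ‖b‖ ^ 2 = 1

/-- The Möbius transformation `z ↦ (a z + b) / (b̄ z + ā)`. -/
noncomputable def DiskMobius.map (γ : DiskMobius) (z : ℂ) : ℂ :=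
  (γ.a * z + γ.b) / ((starRingEnd ℂ) γ.b * z + (starRingEnd ℂ) γ.a)

/-- The inverse transformation (the inverse matrix has entries `ā` and `-b`). -/
noncomputable def DiskMobius.inv (γ : DiskMobius) : DiskMobius where
  a := (starRingEnd ℂ) γ.a
  b := -γ.b
  norm_sq_sub := by
    rw [RCLike.norm_conj, norm_neg]
    exact γ.norm_sq_sub

/-- The hyperbolic Laplacian `(1/4) (1 - |z|²)² (∂²/∂x² + ∂²/∂y²)` of the Poincaré disk. -/
noncomputable def hypLaplacian (f : ℂ → ℝ) (z : ℂ) : ℝ :=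
  1 / 4 * (1 - ‖z‖ ^ 2) ^ 2 * (Δ f) z

/-- `f` is a bounded real function of class `C²` on the disk with `Δ f = -s (1 - s) f`. -/
structure IsBoundedEigenfunction (f : ℂ → ℝ) (s : ℂ) : Prop where
  contDiffOn : ContDiffOn ℝ 2 f disk
  bounded : ∃ M : ℝ, ∀ z ∈ disk, |f z| ≤ M
  eigen : ∀ z ∈ disk, ((hypLaplacian f z : ℝ) : ℂ) = -(s * (1 - s)) * (f z : ℂ)

/-- The point `e^{iθ}` of the circle. -/
noncomputable def cis (θ : ℝ) : ℂ := Complex.exp (θ * Complex.I)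

/-- The point `tanh (r/2) e^{iθ}`, at hyperbolic distance `r` from the origin. -/
noncomputable def polar (r θ : ℝ) : ℂ := (Real.tanh (r / 2) : ℂ) * cis θ

/-- The derivative of `f` along the exterior normal of the hyperbolic circle of radius `r` about
the origin, at `polar r θ`: the derivative with respect to the hyperbolic radius. -/
noncomputable def normalDeriv (f : ℂ → ℝ) (r θ : ℝ) : ℝ :=
  deriv (fun ρ : ℝ => f (polar ρ θ)) r

/-- The nonzero constant `c(s)` for which the distribution below satisfies `⟨D, 1⟩ = f 0`.
The mean of `f` over hyperbolic circles about the origin is `f 0` times the spherical function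
`φ`, so `c(s)` is the limit of `2π e^{-sr} sinh r (φ'(r) + s φ(r))` as `r → ∞`, whose value
is given here. -/
noncomputable def normConst (s : ℂ) : ℂ :=
  2 * (Real.sqrt Real.pi : ℂ) * Complex.Gamma (s + 1 / 2) / Complex.Gamma s

/-- `(1 / c(s)) ∫ Ψ(z) e^{-sr} (∂f/∂n + s f) |dz|` over the arc `{tanh (r/2) ξ | ξ ∈ I}` of the
hyperbolic circle of radius `r`, whose hyperbolic length element is `sinh r dθ`. -/
noncomputable def arcIntegral (f : ℂ → ℝ) (s : ℂ) (I : Set ℂ) (Ψ : ℂ → ℂ) (r : ℝ) : ℂ :=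
  1 / normConst s *
    ∫ θ in {θ : ℝ | θ ∈ Set.Ioc 0 (2 * Real.pi) ∧ cis θ ∈ I},
      Ψ (polar r θ) * Complex.exp (-s * r) *
        ((normalDeriv f r θ : ℂ) + s * (f (polar r θ) : ℂ)) * (Real.sinh r : ℂ)

/-- `Ψ` is an extension of `ψ|_I` of class `C¹` to a neighbourhood of the circle. -/
def IsC1Extension (I : Set ℂ) (ψ Ψ : ℂ → ℂ) : Prop :=
  Set.EqOn Ψ ψ I ∧ ∃ U : Set ℂ, IsOpen U ∧ circle ⊆ U ∧ ContDiffOn ℝ 1 Ψ U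

/-- The Helgason distribution of `f` on piecewise `C¹` test functions: `⟨D_{f,s}, ψ 1_I⟩` is
well defined and equal to `L`. That is, `ψ|_I` has a `C¹` extension to a neighbourhood of the
circle, and whichever one is chosen, the integrals over the arcs converge to `L`. -/
def HasPairing (f : ℂ → ℝ) (s : ℂ) (I : Set ℂ) (ψ : ℂ → ℂ) (L : ℂ) : Prop :=
  (∃ Ψ, IsC1Extension I ψ Ψ) ∧
    ∀ Ψ, IsC1Extension I ψ Ψ →
      Filter.Tendsto (arcIntegral f s I Ψ) Filter.atTop (nhds L)

/-- `ψ` is of class `C¹` on the closure of `I ⊆ circle`, with respect to the angle (one-sided at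
the endpoints). -/
def IsC1OnClosure (I : Set ℂ) (ψ : ℂ → ℂ) : Prop :=
  ContDiffOn ℝ 1 (fun θ : ℝ => ψ (cis θ)) {θ : ℝ | cis θ ∈ closure I}

end Helgason

/-! Write `y = 1 - |z|²` and `w = y^s`. The arc integral is, up to a convergent factor and a
vanishing error, the integral of `Ψ ω` over the arc, where `ω = w *df - f *dw` is the one-form of
Green's second identity. Its exterior derivative is `w Δf - f Δw` times the area form, with the
Euclidean Laplacian. The function `w` satisfies the eigenvalue equation of `f` to leading order at
the circle, so the terms of order `y^(s-2)` cancel and `dω = 4 s² f y^(s-1) dx dy` remains.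

Since `Re s = 1/2` and `f` is bounded, `dω` is `O((1-|z|)^(-1/2))`. An interior gradient estimate,
applied on balls of radius comparable to `1 - |z|`, gives `|∇f| = O(1/(1-|z|))`, so `ω` has the same
order. Multiplying by a `C¹` function `Ψ` preserves both bounds. This singularity is integrable up
to the circle, so Stokes' theorem gives three facts. (a) The flux of `Ψ ω` through arcs of radius
`T` converges as `T → 1`, the radial sides of the region contributing a convergent amount
(`exists_tendsto_flux`). (b) The limit depends only on `Ψ` on the arc: if `Ψ` vanishes there, then
`|Ψ| = O(1-T)` beats the singularity of `ω` (`tendsto_flux_zero`). (c) The circular arc `T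
γ(e^{iθ})` and the image arc `γ(T e^{iθ})` are `O(1-T)` apart and stay at depth at least a constant
times `1-T`, so their fluxes differ by `O((1-T)^(1/2))` (`DiskMobius.tendsto_homotopy`).

Equivariance then follows by pulling back along `γ`. Conformality and `f ∘ γ = f` make `*df`
invariant, and `w ∘ γ = |γ'|^s w`, so `Ψ ω` pulls back to `(Ψ ∘ γ) |γ'|^s ω` plus a term without
derivatives of `f`, of size `O((1-T)^(1/2))` (`DiskMobius.fluxForm_map`). For an extension `Ψ` of
the transported test function, `(Ψ ∘ γ) |γ'|^s` equals `ψ` on `I`, and (b) identifies the two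
limits. -/

open scoped Interval

namespace Helgason

open Set Filter Topology MeasureTheory

/-! ### Interior gradient estimate by a barrier -/

/-- The second derivative is nonpositive at a local maximum. -/
theorem deriv_deriv_nonpos_of_isLocalMax {g : ℝ → ℝ} {x : ℝ} (hg : ContDiffAt ℝ 2 g x)
    (h : IsLocalMax g x) : deriv (deriv g) x ≤ 0 := by
  by_contra! hpos
  have hd : deriv g x = 0 := h.deriv_eq_zero
  have hmin : IsLocalMin g x := isLocalMin_of_deriv_deriv_pos hpos hd hg.continuousAt
  have hc : g =ᶠ[𝓝 x] fun _ => g x := by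
    filter_upwards [h, hmin] with y h1 h2 using le_antisymm h1 h2
  have := hc.deriv.deriv_eq
  simp at this
  linarith

theorem deriv_deriv_sub_half {u v q : ℝ → ℝ} {x : ℝ} (hu : ContDiffAt ℝ 2 u x)
    (hv : ContDiffAt ℝ 2 v x) (hq : ContDiffAt ℝ 2 q x) :
    deriv (deriv fun t => (u t - v t) / 2 - q t) x =
      (deriv (deriv u) x - deriv (deriv v) x) / 2 - deriv (deriv q) x := by
  have hev : ∀ {w : ℝ → ℝ}, ContDiffAt ℝ 2 w x → ∀ᶠ t in 𝓝 x, DifferentiableAt ℝ w t :=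
    fun hw => (hw.eventually (by simp)).mono fun t ht => ht.differentiableAt (by norm_num)
  have hd : ∀ {w : ℝ → ℝ}, ContDiffAt ℝ 2 w x → DifferentiableAt ℝ (deriv w) x :=
    fun hw => (((hw.fderiv_right (m := 1) (by norm_num)).clm_apply
      (contDiffAt_const (c := (1 : ℝ)))).differentiableAt (by norm_num) :)
  have h : (deriv fun t => (u t - v t) / 2 - q t) =ᶠ[𝓝 x]
      fun t => (deriv u t - deriv v t) / 2 - deriv q t := by
    filter_upwards [hev hu, hev hv, hev hq] with t h1 h2 h3
    exact (((h1.hasDerivAt.sub h2.hasDerivAt).div_const 2).sub h3.hasDerivAt).deriv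
  rw [h.deriv_eq]
  exact ((((hd hu).hasDerivAt.sub (hd hv).hasDerivAt).div_const 2).sub (hd hq).hasDerivAt).deriv

theorem deriv_deriv_quadratic {q : ℝ → ℝ} {a b c : ℝ}
    (hq : ∀ t, q t = a * t ^ 2 + b * t + c) (x : ℝ) : deriv (deriv q) x = 2 * a := by
  have h : deriv q = fun t => 2 * a * t + b := by
    funext t
    rw [funext hq]
    exact ((((hasDerivAt_pow 2 t).const_mul a).add ((hasDerivAt_id t).const_mul b)).add_const
      c).congr_deriv (by simp; ring) |>.deriv
  rw [h]
  exact (((hasDerivAt_id x).const_mul (2 * a)).add_const b).congr_deriv (by simp) |>.deriv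

/-- One-sided gradient estimate at the centre of a square, from bounds for a function and for the
sum of its second partial derivatives. -/
theorem deriv_le_of_square {P : ℝ → ℝ → ℝ} {d M N : ℝ} (hd : 0 < d)
    (hc : ContinuousOn (fun p : ℝ × ℝ => P p.1 p.2) (Icc (-d) d ×ˢ Icc (-d) d))
    (hx : ∀ x ∈ Ioo (-d) d, ∀ y ∈ Ioo (-d) d, ContDiffAt ℝ 2 (fun t => P t y) x)
    (hy : ∀ x ∈ Ioo (-d) d, ∀ y ∈ Ioo (-d) d, ContDiffAt ℝ 2 (P x) y)
    (hM : ∀ x ∈ Icc (-d) d, ∀ y ∈ Icc (-d) d, |P x y| ≤ M)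
    (hN : ∀ x ∈ Ioo (-d) d, ∀ y ∈ Ioo (-d) d,
      |deriv (deriv fun t => P t y) x + deriv (deriv (P x)) y| < N) :
    deriv (P 0) 0 ≤ 2 * M / d + d * N / 2 := by
  have hM0 : 0 ≤ M := (abs_nonneg _).trans (hM 0 ⟨by linarith, hd.le⟩ 0 ⟨by linarith, hd.le⟩)
  -- The odd part of `P` in `y` minus a barrier on the upper half of the square. The `M` term is
  -- harmonic and at least `M` on the three outer sides; the `N` term has Laplacian `-N` and
  -- vanishes for `y = 0` and `y = d`. On `y = 0` the odd part vanishes.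
  set W : ℝ × ℝ → ℝ := fun p => (P p.1 p.2 - P p.1 (-p.2)) / 2 -
    (M / d ^ 2 * (p.1 ^ 2 + p.2 * (2 * d - p.2)) + N / 2 * (p.2 * (d - p.2))) with hW
  have hN0 : 0 ≤ N := (abs_nonneg _).trans
    (hN 0 ⟨by linarith, hd⟩ 0 ⟨by linarith, hd⟩).le
  have hcW : ContinuousOn W (Icc (-d) d ×ˢ Icc 0 d) := by
    have h1 : ContinuousOn (fun p : ℝ × ℝ => P p.1 p.2) (Icc (-d) d ×ˢ Icc 0 d) :=
      hc.mono (prod_mono le_rfl (Icc_subset_Icc (by linarith) le_rfl))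
    have h2 : ContinuousOn (fun p : ℝ × ℝ => P p.1 (-p.2)) (Icc (-d) d ×ˢ Icc 0 d) := by
      refine hc.comp (f := fun p : ℝ × ℝ => (p.1, -p.2)) (by fun_prop) ?_
      rintro ⟨x, y⟩ ⟨h1, h2⟩
      simp only [mem_Icc, mem_prod] at *
      exact ⟨h1, by linarith, by linarith⟩
    exact ((h1.sub h2).div_const 2).sub (by fun_prop)
  have key : ∀ p ∈ Icc (-d) d ×ˢ Icc 0 d, W p ≤ 0 := by
    obtain ⟨⟨x, y⟩, hp, hmax⟩ := (isCompact_Icc.prod isCompact_Icc).exists_isMaxOn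
      ⟨((0 : ℝ), (0 : ℝ)), ⟨by constructor <;> linarith, by constructor <;> linarith⟩⟩ hcW
    suffices W (x, y) ≤ 0 from fun p hp => (hmax hp).trans this
    obtain ⟨⟨hx1, hx2⟩, hy1, hy2⟩ := hp
    simp only at hx1 hx2 hy1 hy2
    have hb : |P x y| ≤ M := hM x ⟨hx1, hx2⟩ y ⟨by linarith, hy2⟩
    have hb' : |P x (-y)| ≤ M := hM x ⟨hx1, hx2⟩ (-y) ⟨by linarith, by linarith⟩
    have hpos : 0 ≤ N / 2 * (y * (d - y)) := by
      have : 0 ≤ y * (d - y) := mul_nonneg hy1 (by linarith)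
      positivity
    have hside : d ^ 2 ≤ x ^ 2 + y * (2 * d - y) → W (x, y) ≤ 0 := by
      intro h
      have : M ≤ M / d ^ 2 * (x ^ 2 + y * (2 * d - y)) := by
        calc M = M / d ^ 2 * d ^ 2 := by field_simp
          _ ≤ _ := by gcongr
      simp only [hW]
      linarith [abs_le.1 hb, abs_le.1 hb']
    rcases hy1.eq_or_lt with rfl | hy1
    · simp only [hW, neg_zero, sub_self, zero_div, zero_mul, add_zero, mul_zero, zero_sub]
      have : 0 ≤ M / d ^ 2 * x ^ 2 := by positivity
      linarith
    rcases hy2.eq_or_lt with rfl | hy2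
    · exact hside (by nlinarith [sq_nonneg x])
    rcases hx1.eq_or_lt with rfl | hx1
    · exact hside (by nlinarith)
    rcases hx2.eq_or_lt with rfl | hx2
    · exact hside (by nlinarith)
    -- At an interior maximum both second derivatives of `W` are nonpositive, but their sum is half
    -- a difference of two Laplacians of `P`, each less than `N` in absolute value, plus `N`. The
    -- strict bound on the Laplacian makes this positive.
    exfalso
    have hxm : x ∈ Ioo (-d) d := ⟨hx1, hx2⟩
    have hym : y ∈ Ioo (-d) d := ⟨by linarith, hy2⟩
    have hym' : -y ∈ Ioo (-d) d := ⟨by linarith, by linarith⟩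
    have hloc : IsLocalMax W (x, y) := hmax.isLocalMax
      (prod_mem_nhds (Icc_mem_nhds hx1 hx2) (Icc_mem_nhds hy1 hy2))
    have hlx : IsLocalMax (fun t => W (t, y)) x :=
      hloc.comp_continuous (g := fun t => (t, y)) (by fun_prop)
    have hly : IsLocalMax (fun t => W (x, t)) y :=
      hloc.comp_continuous (g := fun t => (x, t)) (by fun_prop)
    have key1 := hx x hxm y hym
    have key2 := hx x hxm (-y) hym'
    have key3 := hy x hxm y hym
    have key4 : ContDiffAt ℝ 2 (fun t => P x (-t)) y :=
      (hy x hxm (-y) hym').comp y contDiff_neg.contDiffAt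
    have e1 : deriv (deriv fun t => W (t, y)) x =
        (deriv (deriv fun t => P t y) x - deriv (deriv fun t => P t (-y)) x) / 2 -
          2 * M / d ^ 2 := by
      rw [hW, deriv_deriv_sub_half key1 key2 (by fun_prop)]
      congr 1
      rw [deriv_deriv_quadratic (a := M / d ^ 2) (b := 0)
        (c := M / d ^ 2 * (y * (2 * d - y)) + N / 2 * (y * (d - y))) (fun t => by ring)]
      ring
    have e2 : deriv (deriv fun t => W (x, t)) y =
        (deriv (deriv (P x)) y - deriv (deriv (P x)) (-y)) / 2 +
          2 * M / d ^ 2 + N := by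
      rw [hW, deriv_deriv_sub_half key3 key4 (by fun_prop)]
      have : deriv (deriv fun t => P x (-t)) y = deriv (deriv (P x)) (-y) := by
        have h : (deriv fun t => P x (-t)) = fun t => -deriv (P x) (-t) :=
          funext fun t => deriv_comp_neg (P x) t
        rw [h, deriv.fun_neg, deriv_comp_neg (deriv (P x)) y, neg_neg]
      have hq : deriv (deriv fun t => M / d ^ 2 * (x ^ 2 + t * (2 * d - t)) +
          N / 2 * (t * (d - t))) y = 2 * (-(M / d ^ 2) - N / 2) :=
        deriv_deriv_quadratic (b := M / d ^ 2 * (2 * d) + N / 2 * d) (c := M / d ^ 2 * x ^ 2)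
          (fun t => by ring) y
      rw [this, hq]
      ring
    have i1 := deriv_deriv_nonpos_of_isLocalMax (by simp only [hW]; fun_prop) hlx
    have i2 := deriv_deriv_nonpos_of_isLocalMax (by simp only [hW]; fun_prop) hly
    rw [e1] at i1
    rw [e2] at i2
    linarith [abs_lt.1 (hN x hxm y hym), abs_lt.1 (hN x hxm (-y) hym')]
  have hdiff : DifferentiableAt ℝ (P 0) 0 :=
    (hy 0 ⟨by linarith, hd⟩ 0 ⟨by linarith, hd⟩).differentiableAt (by norm_num)
  have h1 := hdiff.hasDerivAt
  have h2 : HasDerivAt (fun y => P 0 (-y)) (-deriv (P 0) 0) 0 := by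
    have : HasDerivAt (P 0) (deriv (P 0) 0) (-0) := by simpa using h1
    exact (this.comp (0 : ℝ) (hasDerivAt_neg (0 : ℝ))).congr_deriv (by ring)
  have h3 : HasDerivAt (fun y => (P 0 y - P 0 (-y)) / 2) (deriv (P 0) 0) 0 := by
    exact ((h1.sub h2).div_const 2).congr_deriv (by ring)
  have h4 := h3.tendsto_slope_zero_right
  refine le_of_tendsto h4 ?_
  filter_upwards [Ioo_mem_nhdsGT hd] with y hy'
  have := key (0, y) ⟨⟨by linarith, hd.le⟩, hy'.1.le, hy'.2.le⟩
  simp only [hW] at this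
  have h0 : y⁻¹ * y = 1 := inv_mul_cancel₀ hy'.1.ne'
  simp only [zero_add, neg_zero, sub_self, zero_div, sub_zero, smul_eq_mul]
  rw [inv_mul_le_iff₀ hy'.1]
  have hy0 := hy'.1
  have a1 : M / d ^ 2 * (0 ^ 2 + y * (2 * d - y)) ≤ y * (2 * M / d) := by
    have : y * (2 * M / d) = M / d ^ 2 * (y * (2 * d)) := by field_simp
    rw [this]
    have : y * (2 * d - y) ≤ y * (2 * d) := by gcongr; linarith
    have h0 : 0 ≤ M / d ^ 2 := by positivity
    nlinarith
  have a2 : N / 2 * (y * (d - y)) ≤ y * (d * N / 2) := by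
    have : y * (d - y) ≤ y * d := by gcongr; linarith
    nlinarith
  linarith

theorem laplacian_eq_fderiv_fderiv (f : ℂ → ℝ) (z : ℂ) :
    (Δ f) z = fderiv ℝ (fderiv ℝ f) z 1 1 + fderiv ℝ (fderiv ℝ f) z Complex.I Complex.I := by
  have := congrFun (InnerProductSpace.laplacian_eq_iteratedFDeriv_complexPlane f) z
  simpa [iteratedFDeriv_two_apply] using this

/-- The trace is the same in every orthonormal basis, so the square in the gradient estimate may be
rotated. -/
theorem bilin_add_bilin_mul_I {F : Type*} [NormedAddCommGroup F] [NormedSpace ℝ F]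
    (B : ℂ →L[ℝ] ℂ →L[ℝ] F) {e : ℂ} (he : ‖e‖ = 1) :
    B e e + B (e * Complex.I) (e * Complex.I) = B 1 1 + B Complex.I Complex.I := by
  have h1 : e = e.re • (1 : ℂ) + e.im • Complex.I := by
    apply Complex.ext <;> simp
  have h2 : e * Complex.I = (-e.im) • (1 : ℂ) + e.re • Complex.I := by
    apply Complex.ext <;> simp
  have h3 : e.re * e.re + e.im * e.im = 1 := by
    have := Complex.sq_norm e
    rw [he, Complex.normSq_apply] at this
    linarith
  have h4 : B e e = B (e.re • (1 : ℂ) + e.im • Complex.I) (e.re • (1 : ℂ) + e.im • Complex.I) := by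
    rw [← h1]
  rw [h2, h4]
  simp only [map_add, map_smul, add_apply, smul_apply]
  have : B 1 1 + B Complex.I Complex.I =
      (e.re * e.re + e.im * e.im) • (B 1 1 + B Complex.I Complex.I) := by rw [h3, one_smul]
  rw [this]
  module

theorem deriv_comp_line {f : ℂ → ℝ} {p v : ℂ} {t : ℝ} (hf : DifferentiableAt ℝ f (p + t * v)) :
    deriv (fun t : ℝ => f (p + t * v)) t = fderiv ℝ f (p + t * v) v := by
  have h : HasDerivAt (fun t : ℝ => p + t * v) v t := by
    simpa using ((Complex.ofRealCLM.hasDerivAt (x := t)).mul_const v).const_add p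
  exact (hf.hasFDerivAt.comp_hasDerivAt t h).deriv

theorem deriv_deriv_comp_line {f : ℂ → ℝ} {p v : ℂ} {t : ℝ}
    (hf : ContDiffAt ℝ 2 f (p + t * v)) :
    deriv (deriv fun t : ℝ => f (p + t * v)) t = fderiv ℝ (fderiv ℝ f) (p + t * v) v v := by
  have h : HasDerivAt (fun t : ℝ => p + t * v) v t := by
    simpa using ((Complex.ofRealCLM.hasDerivAt (x := t)).mul_const v).const_add p
  have hev : (deriv fun t : ℝ => f (p + t * v)) =ᶠ[𝓝 t] fun t => fderiv ℝ f (p + t * v) v := by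
    filter_upwards [h.continuousAt.eventually (hf.eventually (by simp))] with t ht
    exact deriv_comp_line (ht.differentiableAt (by norm_num))
  rw [hev.deriv_eq]
  have h2 := ((hf.fderiv_right (m := 1) (by norm_num)).differentiableAt
    (by norm_num)).hasFDerivAt.comp_hasDerivAt t h
  exact (h2.clm_apply (hasDerivAt_const t v)).deriv.trans (by simp)

/-- Interior gradient estimate for the Poisson equation in the plane. -/
theorem norm_fderiv_le_of_laplacian {f : ℂ → ℝ} {z : ℂ} {ρ M N : ℝ} (hρ : 0 < ρ)
    (hf : ContDiffOn ℝ 2 f (Metric.ball z (2 * ρ)))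
    (hM : ∀ w ∈ Metric.ball z (2 * ρ), |f w| ≤ M)
    (hN : ∀ w ∈ Metric.ball z (2 * ρ), |(Δ f) w| < N) :
    ‖fderiv ℝ f z‖ ≤ 2 * (2 * M / ρ + ρ * N / 2) := by
  have hat : ∀ w ∈ Metric.ball z (2 * ρ), ContDiffAt ℝ 2 f w := fun w hw =>
    hf.contDiffAt (Metric.isOpen_ball.mem_nhds hw)
  have hz : z ∈ Metric.ball z (2 * ρ) := Metric.mem_ball_self (by positivity)
  have key : ∀ e : ℂ, ‖e‖ = 1 → fderiv ℝ f z (e * Complex.I) ≤ 2 * M / ρ + ρ * N / 2 := by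
    intro e he
    have hmem : ∀ x ∈ Icc (-ρ) ρ, ∀ y ∈ Icc (-ρ) ρ,
        z + (x * e + y * (e * Complex.I)) ∈ Metric.ball z (2 * ρ) := by
      intro x hx y hy
      have hx' : |x| ≤ ρ := abs_le.2 hx
      have hy' : |y| ≤ ρ := abs_le.2 hy
      rw [mem_ball_iff_norm, add_sub_cancel_left]
      have h1 : (x * e + y * (e * Complex.I) : ℂ) = e * (x + y * Complex.I) := by ring
      rw [h1, norm_mul, he, one_mul]
      refine lt_of_pow_lt_pow_left₀ 2 (by positivity) ?_
      rw [Complex.sq_norm, Complex.normSq_add_mul_I]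
      nlinarith [abs_nonneg x, abs_nonneg y, sq_abs x, sq_abs y]
    have e1 : ∀ y : ℝ, (fun t : ℝ => f (z + (t * e + y * (e * Complex.I)))) =
        fun t : ℝ => f ((z + y * (e * Complex.I)) + t * e) := fun y => by
      funext t; congr 1; ring
    have e2 : ∀ x : ℝ, (fun t : ℝ => f (z + (x * e + t * (e * Complex.I)))) =
        fun t : ℝ => f ((z + x * e) + t * (e * Complex.I)) := fun x => by
      funext t; congr 1; ring
    have m1 : ∀ x ∈ Icc (-ρ) ρ, ∀ y ∈ Icc (-ρ) ρ,
        (z + y * (e * Complex.I)) + x * e ∈ Metric.ball z (2 * ρ) := by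
      intro x hx y hy
      convert hmem x hx y hy using 1
      ring
    have m2 : ∀ x ∈ Icc (-ρ) ρ, ∀ y ∈ Icc (-ρ) ρ,
        (z + x * e) + y * (e * Complex.I) ∈ Metric.ball z (2 * ρ) := by
      intro x hx y hy
      convert hmem x hx y hy using 1
      ring
    have := deriv_le_of_square (P := fun x y => f (z + (x * e + y * (e * Complex.I)))) (M := M)
      (N := N) hρ ?_ ?_ ?_ ?_ ?_
    · rw [e2, deriv_comp_line (by simpa using (hat z hz).differentiableAt (by norm_num))] at this
      simpa using this
    · refine hf.continuousOn.comp (f := fun p : ℝ × ℝ => z + (p.1 * e + p.2 * (e * Complex.I)))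
        (by fun_prop) ?_
      rintro ⟨x, y⟩ ⟨hx, hy⟩
      exact hmem x hx y hy
    · intro x hx y hy
      exact (hat _ (hmem x (Ioo_subset_Icc_self hx) y (Ioo_subset_Icc_self hy))).comp x
        (f := fun t : ℝ => z + (t * e + y * (e * Complex.I))) (by
          have : ContDiff ℝ 2 fun t : ℝ => (t : ℂ) := Complex.ofRealCLM.contDiff
          fun_prop)
    · intro x hx y hy
      exact (hat _ (hmem x (Ioo_subset_Icc_self hx) y (Ioo_subset_Icc_self hy))).comp y
        (f := fun t : ℝ => z + (x * e + t * (e * Complex.I))) (by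
          have : ContDiff ℝ 2 fun t : ℝ => (t : ℂ) := Complex.ofRealCLM.contDiff
          fun_prop)
    · intro x hx y hy
      exact hM _ (hmem x hx y hy)
    · intro x hx y hy
      have hx' := Ioo_subset_Icc_self hx
      have hy' := Ioo_subset_Icc_self hy
      rw [e1, e2, deriv_deriv_comp_line (hat _ (m1 x hx' y hy')),
        deriv_deriv_comp_line (hat _ (m2 x hx' y hy'))]
      have h : z + y * (e * Complex.I) + x * e = z + x * e + y * (e * Complex.I) := by ring
      rw [h, bilin_add_bilin_mul_I _ he, ← laplacian_eq_fderiv_fderiv]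
      exact hN _ (m2 x hx' y hy')
  -- The four rotations give one-sided bounds in the directions `i`, `-i`, `-1`, `1`, hence bounds
  -- for both partial derivatives.
  have k1 := key 1 (by simp)
  have k2 := key (-1) (by simp)
  have k3 := key Complex.I (by simp)
  have k4 := key (-Complex.I) (by simp)
  simp only [one_mul, neg_mul, Complex.I_mul_I, neg_neg, map_neg] at k1 k2 k3 k4
  have hK : 0 ≤ 2 * M / ρ + ρ * N / 2 := by linarith
  refine ContinuousLinearMap.opNorm_le_bound _ (by positivity) fun v => ?_
  have hv : v = v.re • (1 : ℂ) + v.im • Complex.I := by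
    apply Complex.ext <;> simp
  conv_lhs => rw [hv]
  simp only [map_add, map_smul, smul_eq_mul]
  refine (norm_add_le _ _).trans ?_
  rw [norm_mul, norm_mul, Real.norm_eq_abs, Real.norm_eq_abs, Real.norm_eq_abs,
    Real.norm_eq_abs]
  have a1 : |fderiv ℝ f z 1| ≤ 2 * M / ρ + ρ * N / 2 := abs_le.2 ⟨by linarith, k4⟩
  have a2 : |fderiv ℝ f z Complex.I| ≤ 2 * M / ρ + ρ * N / 2 := abs_le.2 ⟨by linarith, k1⟩
  calc _ ≤ ‖v‖ * (2 * M / ρ + ρ * N / 2) + ‖v‖ * (2 * M / ρ + ρ * N / 2) := by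
        gcongr
        · exact Complex.abs_re_le_norm v
        · exact Complex.abs_im_le_norm v
    _ = _ := by ring

/-! ### Gradient growth of a bounded eigenfunction -/

theorem IsBoundedEigenfunction.laplacian_eq {f : ℂ → ℝ} {s : ℂ} (hf : IsBoundedEigenfunction f s)
    {z : ℂ} (hz : z ∈ disk) :
    (((Δ f) z : ℝ) : ℂ) = -4 * (s * (1 - s)) * f z / ((1 - ‖z‖ ^ 2 : ℝ) : ℂ) ^ 2 := by
  have hy : (1 - ‖z‖ ^ 2 : ℝ) ≠ 0 := by
    have : ‖z‖ < 1 := by simpa [disk] using hz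
    nlinarith [norm_nonneg z]
  have h := hf.eigen z hz
  have hy' : ((1 - ‖z‖ ^ 2 : ℝ) : ℂ) ≠ 0 := by exact_mod_cast hy
  rw [hypLaplacian] at h
  rw [eq_div_iff (pow_ne_zero 2 hy')]
  rw [Complex.ofReal_mul, Complex.ofReal_mul, Complex.ofReal_pow] at h
  push_cast at h ⊢
  linear_combination 4 * h

/-- A bounded eigenfunction has bounded hyperbolic gradient. -/
theorem IsBoundedEigenfunction.exists_norm_fderiv_le {f : ℂ → ℝ} {s : ℂ}
    (hf : IsBoundedEigenfunction f s) :
    ∃ C, 0 ≤ C ∧ ∀ z ∈ disk, ‖fderiv ℝ f z‖ ≤ C / (1 - ‖z‖) := by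
  obtain ⟨M, hM⟩ := hf.bounded
  have hM0 : 0 ≤ M := (abs_nonneg _).trans (hM 0 (by simp [disk]))
  refine ⟨16 * M + 16 * ‖s * (1 - s)‖ * M + 1, by positivity, fun z hz => ?_⟩
  have hz1 : ‖z‖ < 1 := by simpa [disk] using hz
  set ε := 1 - ‖z‖ with hε
  have hε0 : 0 < ε := by linarith
  have hball : ∀ w ∈ Metric.ball z (2 * (ε / 4)), w ∈ disk ∧ ε / 2 ≤ 1 - ‖w‖ ^ 2 := by
    intro w hw
    rw [mem_ball_iff_norm] at hw
    have h1 : ‖w‖ ≤ ‖w - z‖ + ‖z‖ := norm_le_norm_sub_add w z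
    have h2 : ‖w‖ ≤ 1 - ε / 2 := by linarith
    refine ⟨by rw [disk, mem_ball_zero_iff]; linarith, ?_⟩
    nlinarith [norm_nonneg w]
  -- The ball of radius `ε / 2` stays at depth `ε / 2`, where the eigenvalue equation bounds the
  -- Laplacian by a multiple of `ε⁻²`; the summand `1` in `N` only makes the bound strict.
  have h := norm_fderiv_le_of_laplacian (f := f) (z := z) (ρ := ε / 4) (M := M)
    (N := (16 * ‖s * (1 - s)‖ * M + 1) / ε ^ 2) (by positivity)
    (hf.contDiffOn.mono fun w hw => (hball w hw).1) (fun w hw => hM w (hball w hw).1) ?_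
  · refine h.trans (le_of_sub_nonneg ?_)
    have : (16 * M + 16 * ‖s * (1 - s)‖ * M + 1) / ε - 2 * (2 * M / (ε / 4) +
        ε / 4 * ((16 * ‖s * (1 - s)‖ * M + 1) / ε ^ 2) / 2) =
        (12 * ‖s * (1 - s)‖ * M + 3 / 4) / ε := by
      field_simp
      ring
    rw [this]
    positivity
  · intro w hw
    obtain ⟨hwd, hwε⟩ := hball w hw
    have h1 : |(Δ f) w| = ‖(((Δ f) w : ℝ) : ℂ)‖ := by
      rw [Complex.norm_real, Real.norm_eq_abs]
    rw [h1, hf.laplacian_eq hwd, norm_div, norm_mul, norm_mul, norm_pow, Complex.norm_real,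
      Complex.norm_real, Real.norm_eq_abs, Real.norm_eq_abs, abs_of_nonneg (show 0 ≤ 1 - ‖w‖ ^ 2 by linarith)]
    have h4 : ‖(-4 : ℂ)‖ = 4 := by simp
    rw [h4]
    calc 4 * ‖s * (1 - s)‖ * |f w| / (1 - ‖w‖ ^ 2) ^ 2
        ≤ 4 * ‖s * (1 - s)‖ * M / (ε / 2) ^ 2 := by
          gcongr
          exact hM w hwd
      _ = 16 * ‖s * (1 - s)‖ * M / ε ^ 2 := by field_simp; ring
      _ < _ := div_lt_div_of_pos_right (lt_add_one _) (by positivity)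

/-! ### Stokes' theorem on a rectangle -/

/-- Green's formula for the pull-back of a one-form by a map from a rectangle, as an estimate for
the difference of the integrals over two opposite sides. -/
theorem norm_integral_sub_integral_le {ω : ℂ → ℂ →L[ℝ] ℂ} {O : Set ℂ} (hO : IsOpen O)
    (hω : ContDiffOn ℝ 1 ω O) {z : ℝ × ℝ → ℂ} (hz : ContDiff ℝ 2 z) {a b α β K : ℝ}
    (hmaps : ∀ p ∈ [[a, b]] ×ˢ [[α, β]], z p ∈ O)
    (hD : ∀ p ∈ [[a, b]] ×ˢ [[α, β]],
      ‖fderiv ℝ ω (z p) (fderiv ℝ z p (1, 0)) (fderiv ℝ z p (0, 1)) -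
        fderiv ℝ ω (z p) (fderiv ℝ z p (0, 1)) (fderiv ℝ z p (1, 0))‖ ≤ K)
    (hB : ∀ p ∈ [[a, b]] ×ˢ [[α, β]], ‖ω (z p) (fderiv ℝ z p (1, 0))‖ ≤ K) :
    ‖(∫ θ in α..β, ω (z (b, θ)) (fderiv ℝ z (b, θ) (0, 1))) -
      ∫ θ in α..β, ω (z (a, θ)) (fderiv ℝ z (a, θ) (0, 1))‖ ≤ K * |b - a| * (|β - α| + 2) := by
  set V := z ⁻¹' O with hV
  have hVo : IsOpen V := hO.preimage hz.continuous
  have hcomp : ContDiffOn ℝ 1 (fun p => ω (z p)) V :=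
    hω.comp (hz.of_le (by norm_num)).contDiffOn fun p hp => hp
  have hz' : ContDiff ℝ 1 (fderiv ℝ z) := hz.fderiv_right (by norm_num)
  have hF : ∀ h : ℝ × ℝ, ContDiffOn ℝ 1 (fun p => ω (z p) (fderiv ℝ z p h)) V := fun h =>
    hcomp.clm_apply (hz'.contDiffOn.clm_apply contDiffOn_const)
  have hderiv : ∀ h k : ℝ × ℝ, ∀ p ∈ V, fderiv ℝ (fun p => ω (z p) (fderiv ℝ z p h)) p k =
      fderiv ℝ ω (z p) (fderiv ℝ z p k) (fderiv ℝ z p h) +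
        ω (z p) (fderiv ℝ (fderiv ℝ z) p k h) := by
    intro h k p hp
    have h1 : HasFDerivAt (fun p => ω (z p)) ((fderiv ℝ ω (z p)).comp (fderiv ℝ z p)) p :=
      (((hω.differentiableOn (by norm_num)).differentiableAt
        (hO.mem_nhds hp)).hasFDerivAt).comp p
        ((hz.differentiable (by norm_num)).differentiableAt.hasFDerivAt)
    have h2 : HasFDerivAt (fun p => fderiv ℝ z p h) ((fderiv ℝ (fderiv ℝ z) p).flip h) p := by
      have := ((hz'.differentiable (by norm_num)).differentiableAt (x := p)).hasFDerivAt.clm_apply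
        (hasFDerivAt_const h p)
      simpa using this
    have h3 := (h1.clm_apply h2).fderiv
    rw [h3]
    simp [add_comm]
  have hsymm : ∀ p, fderiv ℝ (fderiv ℝ z) p (1, 0) (0, 1) =
      fderiv ℝ (fderiv ℝ z) p (0, 1) (1, 0) := fun p =>
    (hz.contDiffAt.isSymmSndFDerivAt (by simp)).eq _ _
  set A : ℝ × ℝ → ℂ := fun p => ω (z p) (fderiv ℝ z p (0, 1)) with hA
  set B : ℝ × ℝ → ℂ := fun p => ω (z p) (fderiv ℝ z p (1, 0)) with hBdef
  have hdA : ∀ p ∈ V, HasFDerivAt A (fderiv ℝ A p) p := fun p hp =>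
    (((hF (0, 1)).differentiableOn (by norm_num)).differentiableAt (hVo.mem_nhds hp)).hasFDerivAt
  have hdB : ∀ p ∈ V, HasFDerivAt B (fderiv ℝ B p) p := fun p hp =>
    (((hF (1, 0)).differentiableOn (by norm_num)).differentiableAt (hVo.mem_nhds hp)).hasFDerivAt
  have hcA : ContinuousOn (fun p => fderiv ℝ A p) V :=
    (hF (0, 1)).continuousOn_fderiv_of_isOpen hVo (by norm_num)
  have hcB : ContinuousOn (fun p => fderiv ℝ B p) V :=
    (hF (1, 0)).continuousOn_fderiv_of_isOpen hVo (by norm_num)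
  have hsub : [[a, b]] ×ˢ [[α, β]] ⊆ V := hmaps
  have hsub' : Ioo (min a b) (max a b) ×ˢ Ioo (min α β) (max α β) ⊆ V :=
    (Set.prod_mono Ioo_subset_Icc_self Ioo_subset_Icc_self).trans hsub
  -- The pulled-back form is `B dt + A dθ`, so its exterior derivative is the divergence of `(A,
  -- -B)`.
  have green := integral2_divergence_prod_of_hasFDerivAt A (fun p => -B p)
    (fun p => fderiv ℝ A p) (fun p => -fderiv ℝ B p) a α b β
    ((hF (0, 1)).continuousOn.mono hsub) ((hF (1, 0)).continuousOn.mono hsub).neg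
    (fun p hp => hdA p (hsub' hp)) (fun p hp => (hdB p (hsub' hp)).neg)
    (ContinuousOn.integrableOn_compact (isCompact_uIcc.prod isCompact_uIcc)
      (((hcA.mono hsub).clm_apply continuousOn_const).add
        ((hcB.mono hsub).neg.clm_apply continuousOn_const)))
  have hint : ∀ t ∈ Ι a b, ‖∫ θ in α..β, (fderiv ℝ A (t, θ) (1, 0) +
      (-fderiv ℝ B (t, θ)) (0, 1))‖ ≤ K * |β - α| := by
    intro t ht
    refine intervalIntegral.norm_integral_le_of_norm_le_const fun θ hθ => ?_
    have hp : (t, θ) ∈ [[a, b]] ×ˢ [[α, β]] :=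
      ⟨uIoc_subset_uIcc ht, uIoc_subset_uIcc hθ⟩
    have h := hD _ hp
    -- The second derivatives of `z` cancel by symmetry, leaving the exterior derivative of `ω` on
    -- the two tangent vectors.
    rw [neg_apply, hA, hBdef, hderiv _ _ _ (hsub hp), hderiv _ _ _ (hsub hp),
      hsymm]
    refine le_of_eq_of_le (congrArg norm ?_) h
    abel
  have hint2 := intervalIntegral.norm_integral_le_of_norm_le_const hint
  have hside : ∀ θ ∈ [[α, β]], ‖∫ t in a..b, -B (t, θ)‖ ≤ K * |b - a| := fun θ hθ =>
    intervalIntegral.norm_integral_le_of_norm_le_const fun t ht => by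
      rw [norm_neg]
      exact hB _ ⟨uIoc_subset_uIcc ht, hθ⟩
  have h1 := hside α left_mem_uIcc
  have h2 := hside β right_mem_uIcc
  have key : (∫ θ in α..β, A (b, θ)) - ∫ θ in α..β, A (a, θ) =
      (∫ t in a..b, ∫ θ in α..β, (fderiv ℝ A (t, θ) (1, 0) +
      (-fderiv ℝ B (t, θ)) (0, 1))) - (∫ t in a..b, -B (t, β)) + ∫ t in a..b, -B (t, α) := by
    rw [green]; ring
  change ‖(∫ θ in α..β, A (b, θ)) - ∫ θ in α..β, A (a, θ)‖ ≤ _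
  rw [key]
  refine (norm_add_le _ _).trans ((add_le_add_left (norm_sub_le _ _) _).trans ?_)
  calc _ ≤ K * |β - α| * |b - a| + K * |b - a| + K * |b - a| := by gcongr
    _ = _ := by ring

/-! ### The Green form and its exterior derivative -/

/-- The function `(1 - |z|²)^s`. -/
noncomputable def weight (s z : ℂ) : ℂ := Complex.exp (s * (Real.log (1 - ‖z‖ ^ 2) : ℂ))

theorem one_sub_sq_pos {z : ℂ} (hz : z ∈ disk) : 0 < 1 - ‖z‖ ^ 2 := by
  have : ‖z‖ < 1 := by simpa [disk] using hz
  nlinarith [norm_nonneg z]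

theorem norm_weight {s z : ℂ} (hs : s.re = 1 / 2) (hz : z ∈ disk) :
    ‖weight s z‖ = √(1 - ‖z‖ ^ 2) := by
  rw [weight, Complex.norm_exp, Real.sqrt_eq_rpow, Real.rpow_def_of_pos (one_sub_sq_pos hz)]
  simp [hs, mul_comm]

theorem contDiffOn_weight (s : ℂ) : ContDiffOn ℝ 1 (weight s) disk := by
  have h1 : ContDiffOn ℝ 1 (fun z : ℂ => Real.log (1 - ‖z‖ ^ 2)) disk :=
    ContDiffOn.log (contDiffOn_const.sub (contDiff_norm_sq ℝ).contDiffOn)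
      fun z hz => (one_sub_sq_pos hz).ne'
  exact (contDiffOn_const.mul (Complex.ofRealCLM.contDiff.comp_contDiffOn h1)).cexp

/-- The form `(1 - |z|²)^s (*df - f s *d log (1 - |z|²))`. -/
noncomputable def baseForm (f : ℂ → ℝ) (s : ℂ) (z : ℂ) : ℂ →L[ℝ] ℂ :=
  weight s z • (Complex.ofRealCLM ∘L (fderiv ℝ f z ∘L ContinuousLinearMap.mul ℝ ℂ (-Complex.I)) +
    (2 * s * f z / ((1 - ‖z‖ ^ 2 : ℝ) : ℂ)) •
      (Complex.ofRealCLM ∘L (Complex.imCLM ∘L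
        ContinuousLinearMap.mul ℝ ℂ ((starRingEnd ℂ) z))))

theorem baseForm_apply (f : ℂ → ℝ) (s z v : ℂ) :
    baseForm f s z v = weight s z * ((fderiv ℝ f z (-Complex.I * v) : ℝ) +
      2 * s * f z / ((1 - ‖z‖ ^ 2 : ℝ) : ℂ) * (((starRingEnd ℂ) z * v).im : ℝ)) := by
  simp [baseForm, mul_add]

theorem isOpen_disk : IsOpen disk := Metric.isOpen_ball

theorem contDiffOn_baseForm {f : ℂ → ℝ} (hf : ContDiffOn ℝ 2 f disk) (s : ℂ) :
    ContDiffOn ℝ 1 (baseForm f s) disk := by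
  have h1 : ContDiffOn ℝ 1 (fderiv ℝ f) disk := hf.fderiv_of_isOpen isOpen_disk (by norm_num)
  have h2 : ContDiffOn ℝ 1 (fun z => (f z : ℂ)) disk :=
    Complex.ofRealCLM.contDiff.comp_contDiffOn (hf.of_le (by norm_num))
  have h3 : ContDiffOn ℝ 1 (fun z : ℂ => ((1 - ‖z‖ ^ 2 : ℝ) : ℂ)) disk :=
    Complex.ofRealCLM.contDiff.comp_contDiffOn
      (contDiffOn_const.sub (contDiff_norm_sq ℝ).contDiffOn)
  have h4 : ContDiffOn ℝ 1 (fun z : ℂ => ContinuousLinearMap.mul ℝ ℂ ((starRingEnd ℂ) z)) disk :=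
    ((ContinuousLinearMap.mul ℝ ℂ).contDiff.comp Complex.conjCLE.contDiff).contDiffOn
  refine (contDiffOn_weight s).smul (ContDiffOn.add ?_ ?_)
  · exact contDiffOn_const.clm_comp (h1.clm_comp contDiffOn_const)
  · have h5 : ContDiffOn ℝ 1 (fun z : ℂ => 2 * s * f z / ((1 - ‖z‖ ^ 2 : ℝ) : ℂ)) disk :=
      (contDiffOn_const.mul h2).mul (h3.inv fun z hz =>
        Complex.ofReal_ne_zero.2 (one_sub_sq_pos hz).ne')
    exact h5.smul (contDiffOn_const.clm_comp (contDiffOn_const.clm_comp h4))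

theorem hasDerivAt_line (z v : ℂ) (t : ℝ) : HasDerivAt (fun t : ℝ => z + t * v) v t := by
  simpa using ((Complex.ofRealCLM.hasDerivAt (x := t)).mul_const v).const_add z

theorem hasDerivAt_comp_line {F : Type*} [NormedAddCommGroup F] [NormedSpace ℝ F] {g : ℂ → F}
    {z : ℂ} (hg : DifferentiableAt ℝ g z) (v : ℂ) :
    HasDerivAt (fun t : ℝ => g (z + t * v)) (fderiv ℝ g z v) 0 := by
  have h : HasFDerivAt g (fderiv ℝ g z) (z + (0 : ℝ) * v) := by
    rw [Complex.ofReal_zero, zero_mul, add_zero]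
    exact hg.hasFDerivAt
  exact h.comp_hasDerivAt 0 (hasDerivAt_line z v 0)

theorem hasDerivAt_clm_line {F : Type*} [NormedAddCommGroup F] [NormedSpace ℝ F]
    {g : ℂ → ℂ →L[ℝ] F} {z : ℂ} (hg : DifferentiableAt ℝ g z) (v w : ℂ) :
    HasDerivAt (fun t : ℝ => g (z + t * v) w) (fderiv ℝ g z v w) 0 :=
  (ContinuousLinearMap.apply ℝ F w).hasFDerivAt.comp_hasDerivAt 0 (hasDerivAt_comp_line hg v)

theorem hasDerivAt_one_sub_sq_line (z v : ℂ) :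
    HasDerivAt (fun t : ℝ => 1 - ‖z + t * v‖ ^ 2) (-2 * ((starRingEnd ℂ) v * z).re) 0 := by
  refine ((hasDerivAt_line z v 0).norm_sq.const_sub 1).congr_deriv ?_
  rw [Complex.inner]
  simp

theorem hasDerivAt_weight_line {s z v : ℂ} (hz : z ∈ disk) :
    HasDerivAt (fun t : ℝ => weight s (z + t * v))
      (weight s z * (s * (-2 * ((starRingEnd ℂ) v * z).re / (1 - ‖z‖ ^ 2) : ℝ))) 0 := by
  have h := (((hasDerivAt_one_sub_sq_line z v).log
    (by simpa using (one_sub_sq_pos hz).ne')).ofReal_comp.const_mul s).cexp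
  simpa [weight] using h

/-- The differentiated function is `baseForm` at `z + t v` on the vector `i v`. The directions `v =
1` and `v = i` supply the two terms of the exterior derivative. -/
theorem hasDerivAt_normal_line {f : ℂ → ℝ} (hf : ContDiffOn ℝ 2 f disk) {s z v : ℂ}
    (hz : z ∈ disk) (hv : ‖v‖ = 1) :
    HasDerivAt (fun t : ℝ => weight s (z + t * v) * ((fderiv ℝ f (z + t * v) v : ℝ) +
      2 * s * f (z + t * v) / ((1 - ‖z + t * v‖ ^ 2 : ℝ) : ℂ) *
        (((starRingEnd ℂ) v * (z + t * v)).re : ℝ)))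
      (weight s z * ((fderiv ℝ (fderiv ℝ f) z v v : ℝ) +
        2 * s * f z / ((1 - ‖z‖ ^ 2 : ℝ) : ℂ) +
        4 * s * (1 - s) * f z * (((starRingEnd ℂ) v * z).re : ℝ) ^ 2 /
          ((1 - ‖z‖ ^ 2 : ℝ) : ℂ) ^ 2)) 0 := by
  have hat : ContDiffAt ℝ 2 f z := hf.contDiffAt (isOpen_disk.mem_nhds hz)
  have hy : ((1 - ‖z‖ ^ 2 : ℝ) : ℂ) ≠ 0 := by exact_mod_cast (one_sub_sq_pos hz).ne'
  have hl := hasDerivAt_line z v 0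
  have h1 := hasDerivAt_comp_line (hat.differentiableAt (by norm_num)) v
  have h2 := hasDerivAt_clm_line ((hat.fderiv_right (m := 1) (by norm_num)).differentiableAt
    (by norm_num)) v v
  have h3 : HasDerivAt (fun t : ℝ => ((starRingEnd ℂ) v * (z + t * v)).re) 1 0 := by
    have : HasDerivAt (fun t : ℝ => (starRingEnd ℂ) v * (z + t * v)) 1 0 :=
      (hl.const_mul _).congr_deriv (by rw [mul_comm, Complex.mul_conj']; simp [hv])
    exact Complex.reCLM.hasFDerivAt.comp_hasDerivAt 0 this
  have h4 := (hasDerivAt_one_sub_sq_line z v).ofReal_comp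
  have h := (hasDerivAt_weight_line (s := s) (v := v) hz).mul
    (h2.ofReal_comp.add (((h1.ofReal_comp.const_mul (2 * s)).div h4 (by simpa using hy)).mul
      h3.ofReal_comp))
  refine h.congr_deriv ?_
  simp only [Complex.ofReal_zero, zero_mul, add_zero, Complex.ofReal_one, Pi.add_apply,
    Pi.mul_apply, Pi.div_apply, Complex.ofReal_div, Complex.ofReal_mul]
  generalize ((1 - ‖z‖ ^ 2 : ℝ) : ℂ) = y at hy ⊢
  field_simp
  push_cast
  ring

/-- Alternating forms on the plane are multiples of the area form, so only the pair `1`, `i` has to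
be computed. -/
theorem bilin_sub_swap {F : Type*} [NormedAddCommGroup F] [NormedSpace ℝ F]
    (B : ℂ →L[ℝ] ℂ →L[ℝ] F) (v w : ℂ) :
    B v w - B w v = (v.re * w.im - v.im * w.re) • (B 1 Complex.I - B Complex.I 1) := by
  have h : ∀ e : ℂ, e = e.re • (1 : ℂ) + e.im • Complex.I := fun e => by
    apply Complex.ext <;> simp
  have h' : ∀ e e' : ℂ, B e e' =
      B (e.re • (1 : ℂ) + e.im • Complex.I) (e'.re • (1 : ℂ) + e'.im • Complex.I) :=
    fun e e' => by rw [← h, ← h]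
  rw [h' v w, h' w v]
  simp only [map_add, map_smul, add_apply, smul_apply]
  module

/-- The exterior derivative of `baseForm`. -/
theorem fderiv_baseForm_sub {f : ℂ → ℝ} {s : ℂ} (hf : IsBoundedEigenfunction f s) {z : ℂ}
    (hz : z ∈ disk) (v w : ℂ) :
    fderiv ℝ (baseForm f s) z v w - fderiv ℝ (baseForm f s) z w v =
      (v.re * w.im - v.im * w.re) •
        (weight s z * (4 * s ^ 2 * f z / ((1 - ‖z‖ ^ 2 : ℝ) : ℂ))) := by
  have hy : ((1 - ‖z‖ ^ 2 : ℝ) : ℂ) ≠ 0 := by exact_mod_cast (one_sub_sq_pos hz).ne'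
  have hd : DifferentiableAt ℝ (baseForm f s) z :=
    ((contDiffOn_baseForm hf.contDiffOn s).differentiableOn
      (by norm_num)).differentiableAt (isOpen_disk.mem_nhds hz)
  have e1 : fderiv ℝ (baseForm f s) z 1 Complex.I = _ :=
    (hasDerivAt_clm_line hd 1 Complex.I).unique ((hasDerivAt_normal_line (s := s) hf.contDiffOn hz (v := 1)
      (by simp)).congr_of_eventuallyEq (.of_forall fun t => by
        simp [baseForm_apply]))
  have e2 : fderiv ℝ (baseForm f s) z Complex.I 1 = _ :=
    (hasDerivAt_clm_line hd Complex.I 1).unique ((hasDerivAt_normal_line (s := s) hf.contDiffOn hz (v := Complex.I)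
      (by simp)).neg.congr_of_eventuallyEq (.of_forall fun t => by
        simp [baseForm_apply]; ring))
  rw [bilin_sub_swap, e1, e2]
  congr 1
  -- With `y = 1 - |z|²`, the two normal derivatives add up, apart from the weight, to `Δf + 4 s f /
  -- y + 4 s (1 - s) f |z|² / y²`. Since `Δf = -4 s (1 - s) f / y²` and `|z|² = 1 - y`, the `y⁻²`
  -- terms cancel and `4 s² f / y` is left.
  have hL := hf.laplacian_eq hz
  rw [laplacian_eq_fderiv_fderiv, Complex.ofReal_add] at hL
  have hn : (z.re : ℂ) ^ 2 + (z.im : ℂ) ^ 2 = 1 - ((1 - ‖z‖ ^ 2 : ℝ) : ℂ) := by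
    rw [Complex.sq_norm, Complex.normSq_apply]
    push_cast
    ring
  have r1 : ((starRingEnd ℂ) 1 * z).re = z.re := by simp
  have r2 : ((starRingEnd ℂ) Complex.I * z).re = z.im := by simp
  rw [r1, r2]
  generalize ((1 - ‖z‖ ^ 2 : ℝ) : ℂ) = y at *
  have hL' : ((fderiv ℝ (fderiv ℝ f) z 1 1 : ℝ) : ℂ) =
      -4 * (s * (1 - s)) * f z / y ^ 2 -
        (fderiv ℝ (fderiv ℝ f) z Complex.I Complex.I : ℝ) := by
    rw [← hL]; ring
  rw [hL']
  field_simp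
  linear_combination 4 * weight s z * s * (1 - s) * f z * hn

/-! ### Bounds for the form near the circle -/

/-- `Ψ` is of class `C¹` on a neighbourhood of the circle. -/
def IsC1NearCircle (Ψ : ℂ → ℂ) : Prop :=
  ∃ U : Set ℂ, IsOpen U ∧ circle ⊆ U ∧ ContDiffOn ℝ 1 Ψ U

/-- The open annulus `1 - δ < |z| < 1 + δ`. -/
def annulus (δ : ℝ) : Set ℂ := {z | 1 - δ < ‖z‖ ∧ ‖z‖ < 1 + δ}

theorem isOpen_annulus (δ : ℝ) : IsOpen (annulus δ) :=
  (isOpen_lt continuous_const continuous_norm).inter (isOpen_lt continuous_norm continuous_const)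

/-- By compactness the neighbourhood contains a closed tube about the circle, itself compact, on
which `Ψ` and its derivative are bounded. -/
theorem IsC1NearCircle.exists_annulus {Ψ : ℂ → ℂ} (h : IsC1NearCircle Ψ) :
    ∃ δ > 0, δ ≤ 1 / 2 ∧ ContDiffOn ℝ 1 Ψ (annulus δ) ∧
      ∃ C, 0 ≤ C ∧ ∀ z ∈ annulus δ, ‖Ψ z‖ ≤ C ∧ ‖fderiv ℝ Ψ z‖ ≤ C := by
  obtain ⟨U, hU, hcU, hΨ⟩ := h
  obtain ⟨δ, hδ, hsub⟩ := (isCompact_sphere (0 : ℂ) 1).exists_cthickening_subset_open hU hcU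
  have hcomp : IsCompact (Metric.cthickening δ (Metric.sphere (0 : ℂ) 1)) :=
    (isCompact_sphere _ _).cthickening
  obtain ⟨C₁, hC₁⟩ := hcomp.exists_bound_of_continuousOn (hΨ.continuousOn.mono hsub)
  obtain ⟨C₂, hC₂⟩ := hcomp.exists_bound_of_continuousOn
    ((hΨ.continuousOn_fderiv_of_isOpen hU le_rfl).mono hsub)
  have hann : annulus (min δ (1 / 2)) ⊆ Metric.cthickening δ (Metric.sphere (0 : ℂ) 1) := by
    rintro z ⟨h1, h2⟩
    have hm1 := min_le_left δ (1 / 2)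
    have hm2 := min_le_right δ (1 / 2)
    have hz : 0 < ‖z‖ := by linarith
    refine Metric.mem_cthickening_of_dist_le z (z / ‖z‖) δ _ ?_ ?_
    · simp [hz.ne']
    · have : z - z / ‖z‖ = z / ‖z‖ * ((‖z‖ - 1 : ℝ) : ℂ) := by
        have : (‖z‖ : ℂ) ≠ 0 := by exact_mod_cast hz.ne'
        push_cast
        field_simp
      rw [dist_eq_norm, this, norm_mul, Complex.norm_real, norm_div, Complex.norm_real, norm_norm,
        div_self hz.ne', one_mul, Real.norm_eq_abs, abs_le]
      constructor <;> linarith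
  refine ⟨min δ (1 / 2), lt_min hδ (by norm_num), min_le_right _ _, hΨ.mono (hann.trans hsub),
    max 0 (max C₁ C₂), le_max_left _ _, fun z hz => ⟨(hC₁ z (hann hz)).trans ?_,
      (hC₂ z (hann hz)).trans ?_⟩⟩
  · exact (le_max_left _ _).trans (le_max_right _ _)
  · exact (le_max_right _ _).trans (le_max_right _ _)

/-- The form `Ψ (1 - |z|²)^s (*df - f s *d log (1 - |z|²))`. -/
noncomputable def fluxForm (f : ℂ → ℝ) (s : ℂ) (Ψ : ℂ → ℂ) (z : ℂ) : ℂ →L[ℝ] ℂ :=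
  Ψ z • baseForm f s z

/-- For `Re s = 1/2` the weight has size `√(1 - |z|²)`, while `∇f`, the coefficient `2 s f / (1 -
|z|²)` and the factor `4 s² f / (1 - |z|²)` are all `O(1 / (1 - |z|))`. -/
theorem exists_norm_baseForm_le {f : ℂ → ℝ} {s : ℂ} (hs : s.re = 1 / 2)
    (hf : IsBoundedEigenfunction f s) :
    ∃ K, 0 ≤ K ∧ ∀ z ∈ disk, ‖baseForm f s z‖ ≤ K / √(1 - ‖z‖) ∧ ∀ v w : ℂ,
      ‖fderiv ℝ (baseForm f s) z v w - fderiv ℝ (baseForm f s) z w v‖ ≤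
        K / √(1 - ‖z‖) * ‖v‖ * ‖w‖ := by
  obtain ⟨C, hC0, hC⟩ := hf.exists_norm_fderiv_le
  obtain ⟨M, hM⟩ := hf.bounded
  have hM0 : 0 ≤ M := (abs_nonneg _).trans (hM 0 (by simp [disk]))
  refine ⟨2 * (C + 2 * ‖s‖ * M) + 16 * ‖s‖ ^ 2 * M, by positivity, fun z hz => ?_⟩
  have hz1 : ‖z‖ < 1 := by simpa [disk] using hz
  have hy := one_sub_sq_pos hz
  set ε := 1 - ‖z‖ with hε
  have hε0 : 0 < ε := by linarith
  have hyε : ε ≤ 1 - ‖z‖ ^ 2 := by nlinarith [norm_nonneg z]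
  have hyε2 : 1 - ‖z‖ ^ 2 ≤ 2 ^ 2 * ε := by nlinarith [norm_nonneg z]
  have hsq0 : 0 < √ε := Real.sqrt_pos.2 hε0
  have hsq : √ε * √ε = ε := Real.mul_self_sqrt hε0.le
  have hw : ‖weight s z‖ ≤ 2 * √ε := by
    rw [norm_weight hs hz]
    refine (Real.sqrt_le_sqrt hyε2).trans ?_
    rw [Real.sqrt_mul (by norm_num), Real.sqrt_sq (by norm_num)]
  have hf1 : ‖(f z : ℂ)‖ ≤ M := by
    rw [Complex.norm_real]
    exact hM z hz
  have hyn : ‖((1 - ‖z‖ ^ 2 : ℝ) : ℂ)‖ = 1 - ‖z‖ ^ 2 := by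
    rw [Complex.norm_real, Real.norm_of_nonneg hy.le]
  have hred : ∀ A : ℝ, 2 * √ε * (A / ε) = 2 * A / √ε := fun A => by
    nth_rw 2 [← hsq]
    field_simp
  constructor
  · refine ContinuousLinearMap.opNorm_le_bound _ (by positivity) fun v => ?_
    rw [baseForm_apply, norm_mul]
    have h1 : ‖((fderiv ℝ f z (-Complex.I * v) : ℝ) : ℂ)‖ ≤ C / ε * ‖v‖ := by
      rw [Complex.norm_real]
      refine (ContinuousLinearMap.le_opNorm _ _).trans ?_
      rw [norm_mul, norm_neg, Complex.norm_I, one_mul]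
      exact mul_le_mul_of_nonneg_right (hC z hz) (norm_nonneg _)
    have h2 : ‖2 * s * f z / ((1 - ‖z‖ ^ 2 : ℝ) : ℂ) * (((starRingEnd ℂ) z * v).im : ℝ)‖ ≤
        2 * ‖s‖ * M / ε * ‖v‖ := by
      rw [norm_mul, norm_div, hyn, norm_mul, norm_mul, Complex.norm_two]
      have h3 : ‖((((starRingEnd ℂ) z * v).im : ℝ) : ℂ)‖ ≤ ‖v‖ := by
        rw [Complex.norm_real]
        refine (Complex.abs_im_le_norm _).trans ?_
        rw [norm_mul, RCLike.norm_conj]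
        exact mul_le_of_le_one_left (norm_nonneg _) hz1.le
      gcongr
    calc _ ≤ 2 * √ε * (C / ε * ‖v‖ + 2 * ‖s‖ * M / ε * ‖v‖) := by
          gcongr
          exact (norm_add_le _ _).trans (add_le_add h1 h2)
      _ = 2 * √ε * ((C + 2 * ‖s‖ * M) / ε) * ‖v‖ := by ring
      _ ≤ _ := by
          rw [hred]
          gcongr
          exact le_add_of_nonneg_right (by positivity)
  · intro v w
    rw [fderiv_baseForm_sub hf hz, norm_smul, norm_mul, norm_div, hyn, norm_mul, norm_mul, norm_pow]
    have h1 : ‖v.re * w.im - v.im * w.re‖ ≤ 2 * (‖v‖ * ‖w‖) := by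
      refine (norm_sub_le _ _).trans ?_
      rw [norm_mul, norm_mul, two_mul]
      gcongr
      · exact Complex.abs_re_le_norm v
      · exact Complex.abs_im_le_norm w
      · exact Complex.abs_im_le_norm v
      · exact Complex.abs_re_le_norm w
    have h4 : ‖(4 : ℂ)‖ = 4 := by simp
    rw [h4]
    calc _ ≤ 2 * (‖v‖ * ‖w‖) * (2 * √ε * (4 * ‖s‖ ^ 2 * M / ε)) := by gcongr
      _ = 16 * ‖s‖ ^ 2 * M / √ε * (‖v‖ * ‖w‖) := by rw [hred]; ring
      _ ≤ (2 * (C + 2 * ‖s‖ * M) + 16 * ‖s‖ ^ 2 * M) / √ε * (‖v‖ * ‖w‖) := by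
          gcongr
          exact le_add_of_nonneg_left (by positivity)
      _ = _ := by ring

theorem contDiffOn_fluxForm {f : ℂ → ℝ} (hf : ContDiffOn ℝ 2 f disk) (s : ℂ) {Ψ : ℂ → ℂ}
    {δ : ℝ} (hΨ : ContDiffOn ℝ 1 Ψ (annulus δ)) :
    ContDiffOn ℝ 1 (fluxForm f s Ψ) (annulus δ ∩ disk) :=
  (hΨ.mono inter_subset_left).smul ((contDiffOn_baseForm hf s).mono inter_subset_right)

/-- In `d(Ψ ω) = Ψ dω + dΨ ∧ ω` both terms inherit the order `(1 - |z|)^(-1/2)`, because `Ψ` and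
`dΨ` are bounded; the factor `3` counts the three products. -/
theorem exists_norm_fluxForm_le {f : ℂ → ℝ} {s : ℂ} (hs : s.re = 1 / 2)
    (hf : IsBoundedEigenfunction f s) {Ψ : ℂ → ℂ} (hΨ : IsC1NearCircle Ψ) :
    ∃ δ > 0, δ ≤ 1 / 2 ∧ ContDiffOn ℝ 1 (fluxForm f s Ψ) (annulus δ ∩ disk) ∧
      ∃ K, 0 ≤ K ∧ ∀ z ∈ annulus δ ∩ disk, ‖fluxForm f s Ψ z‖ ≤ K / √(1 - ‖z‖) ∧ ∀ v w : ℂ,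
        ‖fderiv ℝ (fluxForm f s Ψ) z v w - fderiv ℝ (fluxForm f s Ψ) z w v‖ ≤
          K / √(1 - ‖z‖) * ‖v‖ * ‖w‖ := by
  obtain ⟨δ, hδ, hδ2, hcont, C, hC0, hC⟩ := hΨ.exists_annulus
  obtain ⟨K, hK0, hK⟩ := exists_norm_baseForm_le hs hf
  refine ⟨δ, hδ, hδ2, contDiffOn_fluxForm hf.contDiffOn s hcont, 3 * C * K, by positivity,
    fun z hz => ?_⟩
  obtain ⟨hK1, hK2⟩ := hK z hz.2
  obtain ⟨hC1, hC2⟩ := hC z hz.1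
  have hP : 0 ≤ K / √(1 - ‖z‖) := by positivity
  constructor
  · rw [fluxForm, norm_smul]
    calc ‖Ψ z‖ * ‖baseForm f s z‖ ≤ C * (K / √(1 - ‖z‖)) := by gcongr
      _ ≤ 3 * (C * (K / √(1 - ‖z‖))) := le_mul_of_one_le_left (by positivity) (by norm_num)
      _ = _ := by ring
  · intro v w
    have hd := ((hcont.differentiableOn (by norm_num)).differentiableAt
      ((isOpen_annulus δ).mem_nhds hz.1)).hasFDerivAt.smul
      (((contDiffOn_baseForm hf.contDiffOn s).differentiableOn (by norm_num)).differentiableAt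
      (isOpen_disk.mem_nhds hz.2)).hasFDerivAt
    have hd' : ∀ v w, fderiv ℝ (fluxForm f s Ψ) z v w =
        Ψ z * fderiv ℝ (baseForm f s) z v w + fderiv ℝ Ψ z v * baseForm f s z w := fun v w => by
      have := hd.fderiv
      change fderiv ℝ (fluxForm f s Ψ) z = _ at this
      rw [this]
      simp
    rw [hd', hd']
    have e : Ψ z * fderiv ℝ (baseForm f s) z v w + fderiv ℝ Ψ z v * baseForm f s z w -
        (Ψ z * fderiv ℝ (baseForm f s) z w v + fderiv ℝ Ψ z w * baseForm f s z v) =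
        Ψ z * (fderiv ℝ (baseForm f s) z v w - fderiv ℝ (baseForm f s) z w v) +
        fderiv ℝ Ψ z v * baseForm f s z w - fderiv ℝ Ψ z w * baseForm f s z v := by ring
    have hb : ∀ v w, ‖fderiv ℝ Ψ z v * baseForm f s z w‖ ≤
        C * ‖v‖ * (K / √(1 - ‖z‖) * ‖w‖) := fun v w => by
      rw [norm_mul]
      gcongr
      · exact (fderiv ℝ Ψ z).le_of_opNorm_le hC2 v
      · exact (baseForm f s z).le_of_opNorm_le hK1 w
    rw [e]
    refine (norm_sub_le _ _).trans ((add_le_add (norm_add_le _ _) (hb w v)).trans ?_)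
    rw [norm_mul]
    calc _ ≤ C * (K / √(1 - ‖z‖) * ‖v‖ * ‖w‖) + C * ‖v‖ * (K / √(1 - ‖z‖) * ‖w‖) +
          C * ‖w‖ * (K / √(1 - ‖z‖) * ‖v‖) := by
          gcongr
          · exact hK2 v w
          · exact hb v w
      _ = _ := by ring

/-! ### Change of the flux under a homotopy of arcs -/

theorem fderiv_prod_left {z : ℝ × ℝ → ℂ} (hz : ContDiff ℝ 2 z) {t θ : ℝ} {v : ℂ}
    (h : HasDerivAt (fun t => z (t, θ)) v t) : fderiv ℝ z (t, θ) (1, 0) = v :=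
  ((hz.differentiable (by norm_num)).differentiableAt.hasFDerivAt.comp_hasDerivAt t
    ((hasDerivAt_id t).prodMk (hasDerivAt_const t θ))).unique h

theorem fderiv_prod_right {z : ℝ × ℝ → ℂ} (hz : ContDiff ℝ 2 z) {t θ : ℝ} {v : ℂ}
    (h : HasDerivAt (fun θ => z (t, θ)) v θ) : fderiv ℝ z (t, θ) (0, 1) = v :=
  ((hz.differentiable (by norm_num)).differentiableAt.hasFDerivAt.comp_hasDerivAt θ
    ((hasDerivAt_const θ t).prodMk (hasDerivAt_id θ))).unique h

/-- Estimate for the change of the flux under a homotopy `z` of arcs, in terms of the two partial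
derivatives `zt` and `zθ` of the homotopy. -/
theorem exists_homotopy_bound {f : ℂ → ℝ} {s : ℂ} (hs : s.re = 1 / 2)
    (hf : IsBoundedEigenfunction f s) {Ψ : ℂ → ℂ} (hΨ : IsC1NearCircle Ψ) :
    ∃ δ > 0, ∃ K, 0 ≤ K ∧ ∀ (z zt zθ : ℝ × ℝ → ℂ) (a b α β m c : ℝ), ContDiff ℝ 2 z →
      (∀ t θ, HasDerivAt (fun t => z (t, θ)) (zt (t, θ)) t) →
      (∀ t θ, HasDerivAt (fun θ => z (t, θ)) (zθ (t, θ)) θ) → 0 ≤ m → 0 ≤ c →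
      (∀ p ∈ [[a, b]] ×ˢ [[α, β]], 1 - δ < ‖z p‖ ∧ ‖z p‖ < 1 ∧ ‖zt p‖ ≤ m * √(1 - ‖z p‖) ∧
        ‖zθ p‖ ≤ c) →
      ‖(∫ θ in α..β, fluxForm f s Ψ (z (b, θ)) (zθ (b, θ))) -
        ∫ θ in α..β, fluxForm f s Ψ (z (a, θ)) (zθ (a, θ))‖ ≤
        K * m * (c + 1) * |b - a| * (|β - α| + 2) := by
  obtain ⟨δ, hδ, -, hcont, K, hK0, hK⟩ := exists_norm_fluxForm_le hs hf hΨ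
  refine ⟨δ, hδ, K, hK0, fun z zt zθ a b α β m c hz ht hθ hm hc h => ?_⟩
  have e1 : ∀ p, fderiv ℝ z p (1, 0) = zt p := fun p => fderiv_prod_left hz (ht p.1 p.2)
  have e2 : ∀ p, fderiv ℝ z p (0, 1) = zθ p := fun p => fderiv_prod_right hz (hθ p.1 p.2)
  have hmem : ∀ p ∈ [[a, b]] ×ˢ [[α, β]], z p ∈ annulus δ ∩ disk := fun p hp => by
    obtain ⟨h1, h2, -, -⟩ := h p hp
    exact ⟨⟨h1, by linarith⟩, by simpa [disk] using h2⟩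
  -- The homotopy speed compensates the singularity of the form exactly.
  have hmul : ∀ p ∈ [[a, b]] ×ˢ [[α, β]], K / √(1 - ‖z p‖) * ‖zt p‖ ≤ K * m := fun p hp => by
    obtain ⟨-, h2, h3, -⟩ := h p hp
    have : 0 < √(1 - ‖z p‖) := Real.sqrt_pos.2 (by linarith)
    calc _ ≤ K / √(1 - ‖z p‖) * (m * √(1 - ‖z p‖)) := by gcongr
      _ = _ := by field_simp
  have := norm_integral_sub_integral_le ((isOpen_annulus δ).inter isOpen_disk) hcont hz
    (a := a) (b := b) (α := α) (β := β) (K := K * m * (c + 1)) hmem (fun p hp => ?_)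
    (fun p hp => ?_)
  · simpa only [e2] using this
  · rw [e1, e2]
    refine ((hK _ (hmem p hp)).2 _ _).trans ?_
    have := (h p hp).2.2.2
    have h0 : 0 ≤ K * m := by positivity
    exact mul_le_mul (hmul p hp) (by linarith) (norm_nonneg _) h0
  · rw [e1]
    refine ((fluxForm f s Ψ (z p)).le_of_opNorm_le (hK _ (hmem p hp)).1 _).trans
      ((hmul p hp).trans ?_)
    have h0 : 0 ≤ K * m := by positivity
    nlinarith

/-! ### The flux through circular arcs and its limit -/

theorem norm_cis (θ : ℝ) : ‖cis θ‖ = 1 := Complex.norm_exp_ofReal_mul_I θ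

theorem hasDerivAt_cis (θ : ℝ) : HasDerivAt cis (Complex.I * cis θ) θ := by
  have h := ((hasDerivAt_id θ).ofReal_comp.mul_const Complex.I).cexp
  refine h.congr_deriv ?_
  simp [cis, mul_comm]

theorem contDiff_cis {n : WithTop ℕ∞} : ContDiff ℝ n cis :=
  (Complex.ofRealCLM.contDiff.mul contDiff_const).cexp

theorem continuous_cis : Continuous cis := contDiff_cis (n := 0).continuous

theorem norm_ofReal_mul_cis {T : ℝ} (hT : 0 ≤ T) (θ : ℝ) : ‖(T : ℂ) * cis θ‖ = T := by
  rw [norm_mul, norm_cis, mul_one, Complex.norm_real, Real.norm_of_nonneg hT]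

/-- The integral of `fluxForm` over an arc of the circle of Euclidean radius `T`. -/
noncomputable def flux (f : ℂ → ℝ) (s : ℂ) (Ψ : ℂ → ℂ) (α β T : ℝ) : ℂ :=
  ∫ θ in α..β, fluxForm f s Ψ (T * cis θ) (T * (Complex.I * cis θ))

/-- With `T = 1 - τ²` the radial speed is `2 τ = 2 √(1 - T)`, which absorbs the singularity. The
flux is therefore Lipschitz in `τ` near `0`, hence Cauchy. -/
theorem exists_tendsto_flux {f : ℂ → ℝ} {s : ℂ} (hs : s.re = 1 / 2)
    (hf : IsBoundedEigenfunction f s) {Ψ : ℂ → ℂ} (hΨ : IsC1NearCircle Ψ) (α β : ℝ) :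
    ∃ L, Tendsto (flux f s Ψ α β) (𝓝[<] 1) (𝓝 L) := by
  obtain ⟨δ, hδ, K, hK0, hK⟩ := exists_homotopy_bound hs hf hΨ
  set τ₀ := min 1 δ with hτ₀
  have hτ₀0 : 0 < τ₀ := lt_min one_pos hδ
  have hlip : ∀ a ∈ Ioo 0 τ₀, ∀ b ∈ Ioo 0 τ₀,
      ‖flux f s Ψ α β (1 - b ^ 2) - flux f s Ψ α β (1 - a ^ 2)‖ ≤
        K * 2 * (1 + 1) * (|β - α| + 2) * |b - a| := by
    intro a ha b hb
    have := hK (fun p => ((1 - p.1 ^ 2 : ℝ) : ℂ) * cis p.2)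
      (fun p => ((-2 * p.1 : ℝ) : ℂ) * cis p.2)
      (fun p => ((1 - p.1 ^ 2 : ℝ) : ℂ) * (Complex.I * cis p.2)) a b α β 2 1 ?_ ?_ ?_ (by norm_num)
      (by norm_num) ?_
    · refine this.trans (le_of_eq (by ring))
    · exact (Complex.ofRealCLM.contDiff.comp (by fun_prop : ContDiff ℝ 2
        fun p : ℝ × ℝ => 1 - p.1 ^ 2)).mul (contDiff_cis.comp contDiff_snd)
    · intro t θ
      have h : HasDerivAt (fun t : ℝ => 1 - t ^ 2) (-2 * t) t :=
        ((hasDerivAt_pow 2 t).const_sub 1).congr_deriv (by simp)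
      exact h.ofReal_comp.mul_const (cis θ)
    · intro t θ
      exact (hasDerivAt_cis θ).const_mul ((1 - t ^ 2 : ℝ) : ℂ)
    · rintro ⟨t, θ⟩ ⟨ht, -⟩
      have ht' : t ∈ Ioo 0 τ₀ := by
        simp only [mem_uIcc] at ht
        rcases ht with h | h
        · exact ⟨by linarith [ha.1], by linarith [hb.2]⟩
        · exact ⟨by linarith [hb.1], by linarith [ha.2]⟩
      have h1 : t < 1 := ht'.2.trans_le (min_le_left _ _)
      have h2 : t < δ := ht'.2.trans_le (min_le_right _ _)
      have h0 : 0 < t := ht'.1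
      have hn : 0 ≤ 1 - t ^ 2 := by nlinarith
      simp only [norm_ofReal_mul_cis hn, norm_mul, norm_cis, Complex.norm_I, Complex.norm_real,
        sub_sub_cancel, Real.sqrt_sq h0.le, Real.norm_of_nonneg hn, mul_one, norm_neg,
        Real.norm_ofNat]
      refine ⟨by nlinarith, by nlinarith, by rw [Real.norm_of_nonneg h0.le], by nlinarith⟩
  have hcau : Cauchy (map (fun τ : ℝ => flux f s Ψ α β (1 - τ ^ 2)) (𝓝[>] 0)) := by
    refine (cauchy_nhds.mono nhdsWithin_le_nhds : Cauchy (𝓝[>] (0 : ℝ))).map_of_le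
      (s := Ioo 0 τ₀) ?_ (le_principal_iff.2 (Ioo_mem_nhdsGT hτ₀0))
    refine (LipschitzOnWith.of_dist_le_mul (K := (K * 2 * (1 + 1) * (|β - α| + 2)).toNNReal)
      fun b hb a ha => ?_).uniformContinuousOn
    rw [Real.coe_toNNReal _ (by positivity), dist_eq_norm, Real.dist_eq]
    exact hlip a ha b hb
  obtain ⟨L, hL⟩ := cauchy_map_iff_exists_tendsto.1 hcau
  have hsqrt : Tendsto (fun T : ℝ => √(1 - T)) (𝓝[<] 1) (𝓝[>] 0) := by
    refine tendsto_nhdsWithin_iff.2 ⟨?_, ?_⟩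
    · have : Tendsto (fun T : ℝ => √(1 - T)) (𝓝 1) (𝓝 √(1 - 1)) :=
        (by fun_prop : Continuous fun T : ℝ => √(1 - T)).tendsto 1
      simpa using this.mono_left nhdsWithin_le_nhds
    · filter_upwards [self_mem_nhdsWithin] with T hT
      exact Real.sqrt_pos.2 (sub_pos.2 hT)
  refine ⟨L, (hL.comp hsqrt).congr' ?_⟩
  filter_upwards [self_mem_nhdsWithin] with T hT
  simp only [Function.comp]
  rw [Real.sq_sqrt (sub_nonneg.2 (le_of_lt hT)), sub_sub_cancel]

/-! ### Comparison of arc integrals with the flux -/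

theorem flux_eq_weight (f : ℂ → ℝ) (s : ℂ) (Ψ : ℂ → ℂ) {T : ℝ} (hT : 0 ≤ T) (θ : ℝ) :
    fluxForm f s Ψ (T * cis θ) (T * (Complex.I * cis θ)) =
      Ψ (T * cis θ) * (weight s (T * cis θ) * (T * (fderiv ℝ f (T * cis θ) (cis θ) : ℝ) +
        2 * s * f (T * cis θ) / ((1 - T ^ 2 : ℝ) : ℂ) * T ^ 2)) := by
  have h1 : -Complex.I * (T * (Complex.I * cis θ)) = T • cis θ := by
    rw [Complex.real_smul]
    linear_combination (-T * cis θ) * Complex.I_mul_I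
  have h2 : (starRingEnd ℂ) (T * cis θ) * (T * (Complex.I * cis θ)) =
      ((T ^ 2 : ℝ) : ℂ) * Complex.I := by
    have := Complex.conj_mul' (cis θ)
    rw [norm_cis] at this
    rw [map_mul, Complex.conj_ofReal]
    push_cast at this ⊢
    linear_combination (T ^ 2 * Complex.I) * this
  rw [fluxForm, smul_apply, baseForm_apply, h1, h2, norm_ofReal_mul_cis hT, map_smul,
    Complex.im_ofReal_mul, Complex.I_im, mul_one]
  push_cast
  simp

theorem normalDeriv_eq {f : ℂ → ℝ} (hf : ContDiffOn ℝ 2 f disk) (r θ : ℝ) :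
    normalDeriv f r θ =
      (1 - Real.tanh (r / 2) ^ 2) / 2 * fderiv ℝ f (polar r θ) (cis θ) := by
  have hmem : polar r θ ∈ disk := by
    rw [disk, mem_ball_zero_iff, polar, norm_mul, norm_cis, mul_one, Complex.norm_real]
    exact abs_lt.2 ⟨Real.neg_one_lt_tanh _, Real.tanh_lt_one _⟩
  have h1 : HasDerivAt (fun ρ : ℝ => Real.tanh (ρ / 2)) ((1 - Real.tanh (r / 2) ^ 2) / 2) r := by
    have hc := (Real.cosh_pos (r / 2)).ne'
    have h2 : HasDerivAt (fun ρ : ℝ => ρ / 2) (1 / 2) r := (hasDerivAt_id r).div_const 2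
    have hsh : HasDerivAt (fun ρ : ℝ => Real.sinh (ρ / 2)) (Real.cosh (r / 2) * (1 / 2)) r :=
      h2.sinh
    have hch : HasDerivAt (fun ρ : ℝ => Real.cosh (ρ / 2)) (Real.sinh (r / 2) * (1 / 2)) r :=
      h2.cosh
    refine ((hsh.div hch hc).congr_of_eventuallyEq (.of_forall fun ρ => Real.tanh_eq_sinh_div_cosh _)
      ).congr_deriv ?_
    simp only [Real.tanh_eq_sinh_div_cosh]
    field_simp
  have h2 : HasDerivAt (fun ρ => polar ρ θ)
      ((((1 - Real.tanh (r / 2) ^ 2) / 2 : ℝ) : ℂ) * cis θ) r := h1.ofReal_comp.mul_const _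
  have h3 := ((hf.contDiffAt (isOpen_disk.mem_nhds hmem)).differentiableAt
    (by norm_num)).hasFDerivAt.comp_hasDerivAt r h2
  rw [normalDeriv]
  refine h3.deriv.trans ?_
  rw [← Complex.real_smul, map_smul, smul_eq_mul]

theorem log_one_sub_tanh_sq (r : ℝ) : Real.log (1 - Real.tanh (r / 2) ^ 2) =
    -r + 2 * Real.log (1 + Real.tanh (r / 2)) := by
  have hc := Real.cosh_pos (r / 2)
  have hsq := Real.cosh_sq (r / 2)
  have e1 : 1 - Real.tanh (r / 2) ^ 2 = (Real.cosh (r / 2) ^ 2)⁻¹ := by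
    rw [Real.tanh_eq_sinh_div_cosh]
    field_simp
    linarith
  have e2 : 1 + Real.tanh (r / 2) = Real.exp (r / 2) / Real.cosh (r / 2) := by
    rw [Real.tanh_eq_sinh_div_cosh, ← Real.cosh_add_sinh]
    field_simp
  rw [e1, e2, Real.log_inv, Real.log_pow, Real.log_div (Real.exp_ne_zero _) hc.ne', Real.log_exp]
  push_cast
  ring

theorem sinh_eq_tanh (r : ℝ) :
    Real.sinh r * (1 - Real.tanh (r / 2) ^ 2) = 2 * Real.tanh (r / 2) := by
  have hc := (Real.cosh_pos (r / 2)).ne'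
  have hsq := Real.cosh_sq (r / 2)
  have : Real.sinh r = 2 * Real.sinh (r / 2) * Real.cosh (r / 2) := by
    rw [← Real.sinh_two_mul]; congr 1; ring
  rw [this, Real.tanh_eq_sinh_div_cosh]
  field_simp
  rw [hsq]
  ring

/-- The integrand of `arcIntegral`. -/
noncomputable def arcIntegrand (f : ℂ → ℝ) (s : ℂ) (Ψ : ℂ → ℂ) (r θ : ℝ) : ℂ :=
  Ψ (polar r θ) * Complex.exp (-s * r) *
    ((normalDeriv f r θ : ℂ) + s * (f (polar r θ) : ℂ)) * (Real.sinh r : ℂ)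

/-- With `T = tanh (r/2)` one has `e^{-r} = (1 - T²) / (1 + T)²`, `∂_r = ((1 - T²) / 2) ∂_T` and
`sinh r = 2 T / (1 - T²)`. The derivative terms agree; the coefficients of `s f` are `2 T / (1 -
T²)` and `2 T² / (1 - T²)`, whose difference `2 T / (1 + T)` stays bounded. -/
theorem arcIntegrand_eq {f : ℂ → ℝ} (hf : ContDiffOn ℝ 2 f disk) (s : ℂ) (Ψ : ℂ → ℂ)
    {r : ℝ} (hr : 0 ≤ r) (θ : ℝ) :
    arcIntegrand f s Ψ r θ = Complex.exp (-(2 * s) * (Real.log (1 + Real.tanh (r / 2)) : ℝ)) *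
      (fluxForm f s Ψ (polar r θ) (Real.tanh (r / 2) * (Complex.I * cis θ)) +
        2 * s * (Real.tanh (r / 2) / (1 + Real.tanh (r / 2)) : ℝ) *
          (Ψ (polar r θ) * (weight s (polar r θ) * f (polar r θ)))) := by
  have hT0 : 0 ≤ Real.tanh (r / 2) := by
    rw [Real.tanh_eq_sinh_div_cosh]
    exact div_nonneg (Real.sinh_nonneg_iff.2 (by linarith)) (Real.cosh_pos _).le
  have hT1 := Real.tanh_lt_one (r / 2)
  have hsinh : (Real.sinh r : ℂ) * ((1 - Real.tanh (r / 2) ^ 2 : ℝ) : ℂ) =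
      2 * (Real.tanh (r / 2) : ℂ) := by exact_mod_cast sinh_eq_tanh r
  have hexp : Complex.exp (-s * r) = weight s (polar r θ) *
      Complex.exp (-(2 * s) * (Real.log (1 + Real.tanh (r / 2)) : ℝ)) := by
    rw [weight, polar, norm_ofReal_mul_cis hT0, log_one_sub_tanh_sq, ← Complex.exp_add]
    congr 1
    push_cast
    ring
  have hn := normalDeriv_eq hf r θ
  rw [arcIntegrand, hexp, hn]
  rw [polar, flux_eq_weight f s Ψ hT0 θ]
  have hsinh' : (Real.sinh r : ℂ) =
      2 * (Real.tanh (r / 2) : ℂ) / ((1 - Real.tanh (r / 2) ^ 2 : ℝ) : ℂ) := by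
    rw [eq_div_iff (Complex.ofReal_ne_zero.2 (by nlinarith)), hsinh]
  rw [hsinh']
  generalize Real.tanh (r / 2) = T at hT0 hT1 ⊢
  generalize Complex.exp (-(2 * s) * (Real.log (1 + T) : ℝ)) = e
  have hy : (1 + (T : ℂ)) ≠ 0 := by exact_mod_cast (by linarith : 1 + T ≠ 0)
  have hy2 : (1 - (T : ℂ)) ≠ 0 := by exact_mod_cast (by linarith : 1 - T ≠ 0)
  have hy3 : (1 - (T : ℂ) ^ 2) = (1 - T) * (1 + T) := by ring
  push_cast
  rw [hy3]
  field_simp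
  ring

theorem tendsto_tanh_half : Tendsto (fun r : ℝ => Real.tanh (r / 2)) atTop (𝓝[<] 1) := by
  refine tendsto_nhdsWithin_iff.2 ⟨?_, .of_forall fun r => Real.tanh_lt_one _⟩
  have h : ∀ r : ℝ, 1 - 2 / (Real.exp r + 1) = Real.tanh (r / 2) := fun r => by
    have h0 := Real.exp_pos (r / 2)
    rw [Real.tanh_eq, Real.exp_neg]
    have : Real.exp r = Real.exp (r / 2) ^ 2 := by
      rw [← Real.exp_nat_mul]; congr 1; push_cast; ring
    rw [this]
    field_simp
    ring
  have h1 : Tendsto (fun r : ℝ => 1 - 2 / (Real.exp r + 1)) atTop (𝓝 (1 - 0)) :=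
    tendsto_const_nhds.sub ((tendsto_const_nhds (x := (2 : ℝ))).div_atTop
      (Real.tendsto_exp_atTop.atTop_add tendsto_const_nhds))
  simpa [h] using h1

theorem eventually_mul_cis_mem {δ : ℝ} (hδ : 0 < δ) : ∀ᶠ T : ℝ in 𝓝[<] 1, 0 < T ∧ T < 1 ∧
    ∀ θ : ℝ, (T : ℂ) * cis θ ∈ annulus δ ∩ disk := by
  filter_upwards [Ioo_mem_nhdsLT (show max 0 (1 - δ) < 1 from max_lt one_pos (by linarith))]
    with T hT
  have h0 : 0 < T := (le_max_left _ _).trans_lt hT.1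
  have h1 : 1 - δ < T := (le_max_right _ _).trans_lt hT.1
  refine ⟨h0, hT.2, fun θ => ⟨?_, ?_⟩⟩
  · rw [annulus, mem_ofPred_eq, norm_ofReal_mul_cis h0.le]
    exact ⟨h1, by linarith [hT.2]⟩
  · rw [disk, mem_ball_zero_iff, norm_ofReal_mul_cis h0.le]
    exact hT.2

theorem eventually_continuous_fluxForm {f : ℂ → ℝ} (hf : ContDiffOn ℝ 2 f disk) (s : ℂ)
    {Ψ : ℂ → ℂ} (hΨ : IsC1NearCircle Ψ) : ∀ᶠ T : ℝ in 𝓝[<] 1,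
      Continuous fun θ : ℝ => fluxForm f s Ψ (T * cis θ) (T * (Complex.I * cis θ)) := by
  obtain ⟨δ, hδ, -, hcont, -⟩ := hΨ.exists_annulus
  filter_upwards [eventually_mul_cis_mem hδ] with T ⟨_, _, hT⟩
  have hc := continuous_cis
  exact ((contDiffOn_fluxForm hf s hcont).continuousOn.comp_continuous (by fun_prop) hT).clm_apply
    (by fun_prop)

/-- The zeroth order term `Ψ (1 - |z|²)^s f` tends to zero at the circle. -/
theorem exists_eventually_norm_mass_le {f : ℂ → ℝ} {s : ℂ} (hs : s.re = 1 / 2)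
    (hf : IsBoundedEigenfunction f s) {Ψ : ℂ → ℂ} (hΨ : IsC1NearCircle Ψ) :
    ∃ C, 0 ≤ C ∧ ∀ᶠ T : ℝ in 𝓝[<] 1,
      (Continuous fun θ : ℝ => Ψ (T * cis θ) * (weight s (T * cis θ) * f (T * cis θ))) ∧
      ∀ θ : ℝ, ‖Ψ (T * cis θ) * (weight s (T * cis θ) * f (T * cis θ))‖ ≤ C * √(1 - T) := by
  obtain ⟨δ, hδ, -, hcont, C, hC0, hC⟩ := hΨ.exists_annulus
  obtain ⟨M, hM⟩ := hf.bounded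
  have hM0 : 0 ≤ M := (abs_nonneg _).trans (hM 0 (by simp [disk]))
  refine ⟨C * (2 * M), by positivity, ?_⟩
  filter_upwards [eventually_mul_cis_mem hδ] with T ⟨hT0, hT1, hT⟩
  have hc := continuous_cis
  refine ⟨?_, fun θ => ?_⟩
  · have h : ContinuousOn (fun z => Ψ z * (weight s z * f z)) (annulus δ ∩ disk) :=
      (hcont.continuousOn.mono inter_subset_left).mul
      (((contDiffOn_weight s).continuousOn.mono inter_subset_right).mul
        (Complex.continuous_ofReal.comp_continuousOn
          (hf.contDiffOn.continuousOn.mono inter_subset_right)))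
    exact h.comp_continuous (by fun_prop) hT
  · rw [norm_mul, norm_mul, norm_weight hs (hT θ).2, Complex.norm_real,
      norm_ofReal_mul_cis hT0.le]
    have h1 : √(1 - T ^ 2) ≤ 2 * √(1 - T) := by
      rw [Real.sqrt_le_left (by positivity), mul_pow, Real.sq_sqrt (by linarith)]
      nlinarith
    calc _ ≤ C * (2 * √(1 - T) * M) := by
          gcongr
          · exact (hC _ (hT θ).1).1
          · exact hM _ (hT θ).2
      _ = _ := by ring

theorem tendsto_sqrt_one_sub (A : ℝ) : Tendsto (fun T : ℝ => A * √(1 - T)) (𝓝[<] 1) (𝓝 0) := by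
  have : Tendsto (fun T : ℝ => A * √(1 - T)) (𝓝 1) (𝓝 (A * √(1 - 1))) :=
    (by fun_prop : Continuous fun T : ℝ => A * √(1 - T)).tendsto 1
  simpa using this.mono_left nhdsWithin_le_nhds

/-- The discrepancy with the flux is `O(√(1 - T))`, and the prefactor `(1 + T)^(-2s)` tends to
`2^(-2s)`. -/
theorem tendsto_integral_arcIntegrand {f : ℂ → ℝ} {s : ℂ} (hs : s.re = 1 / 2)
    (hf : IsBoundedEigenfunction f s) {Ψ : ℂ → ℂ} (hΨ : IsC1NearCircle Ψ) {α β : ℝ} {L : ℂ}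
    (hL : Tendsto (flux f s Ψ α β) (𝓝[<] 1) (𝓝 L)) :
    Tendsto (fun r => ∫ θ in α..β, arcIntegrand f s Ψ r θ) atTop
      (𝓝 (Complex.exp (-(2 * s) * (Real.log 2 : ℝ)) * L)) := by
  obtain ⟨C, hC0, hC⟩ := exists_eventually_norm_mass_le hs hf hΨ
  set m : ℝ → ℝ → ℂ := fun T θ => Ψ (T * cis θ) * (weight s (T * cis θ) * f (T * cis θ)) with hm
  have hmass : Tendsto (fun T : ℝ => 2 * s * (T / (1 + T) : ℝ) * ∫ θ in α..β, m T θ) (𝓝[<] 1)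
      (𝓝 0) := by
    have h1 : Tendsto (fun T : ℝ => ∫ θ in α..β, m T θ) (𝓝[<] 1) (𝓝 0) := by
      refine squeeze_zero_norm' ?_ (tendsto_sqrt_one_sub (C * |β - α|))
      filter_upwards [hC] with T hT
      refine (intervalIntegral.norm_integral_le_of_norm_le_const fun θ _ => hT.2 θ).trans
        (le_of_eq (by ring))
    have h2 : Tendsto (fun T : ℝ => 2 * s * ((T / (1 + T) : ℝ) : ℂ)) (𝓝[<] 1)
        (𝓝 (2 * s * ((1 / (1 + 1) : ℝ) : ℂ))) := by
      refine Tendsto.mono_left (Tendsto.const_mul _ ?_) nhdsWithin_le_nhds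
      exact (Complex.continuous_ofReal.tendsto _).comp
        (tendsto_id.div (tendsto_const_nhds.add tendsto_id) (by norm_num))
    simpa using h2.mul h1
  have hexp : Tendsto (fun T : ℝ => Complex.exp (-(2 * s) * (Real.log (1 + T) : ℝ))) (𝓝[<] 1)
      (𝓝 (Complex.exp (-(2 * s) * (Real.log (1 + 1) : ℝ)))) := by
    refine Tendsto.mono_left ?_ nhdsWithin_le_nhds
    refine (Complex.continuous_exp.tendsto _).comp (Tendsto.const_mul _ ?_)
    exact (Complex.continuous_ofReal.tendsto _).comp
      ((tendsto_const_nhds.add tendsto_id).log (by norm_num))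
  have key := (hexp.mul (hL.add hmass)).comp tendsto_tanh_half
  rw [add_zero, one_add_one_eq_two] at key
  refine key.congr' ?_
  filter_upwards [tendsto_tanh_half.eventually (eventually_continuous_fluxForm hf.contDiffOn s hΨ),
    tendsto_tanh_half.eventually hC, eventually_ge_atTop 0] with r h1 h2 hr
  simp only [Function.comp, arcIntegrand_eq hf.contDiffOn s Ψ hr, flux]
  rw [intervalIntegral.integral_const_mul, intervalIntegral.integral_add,
    intervalIntegral.integral_const_mul]
  · rfl
  · exact h1.intervalIntegrable _ _
  · exact (continuous_const.mul h2.1).intervalIntegrable _ _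

/-! ### Independence of the extension -/

/-- The limit of the flux only depends on the test function on the arc. -/
theorem tendsto_flux_zero {f : ℂ → ℝ} {s : ℂ} (hs : s.re = 1 / 2)
    (hf : IsBoundedEigenfunction f s) {Ψ : ℂ → ℂ} (hΨ : IsC1NearCircle Ψ) {α β : ℝ} (hαβ : α ≤ β)
    (h0 : ∀ θ ∈ Ioo α β, Ψ (cis θ) = 0) : Tendsto (flux f s Ψ α β) (𝓝[<] 1) (𝓝 0) := by
  obtain ⟨δ, hδ, -, hcont, C, hC0, hC⟩ := hΨ.exists_annulus
  obtain ⟨K, hK0, hK⟩ := exists_norm_baseForm_le hs hf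
  refine squeeze_zero_norm' ?_ (tendsto_sqrt_one_sub (C * K * |β - α|))
  filter_upwards [eventually_mul_cis_mem hδ] with T ⟨hT0, hT1, hT⟩
  have hpt : ∀ θ ∈ Ioo α β, ‖fluxForm f s Ψ (T * cis θ) (T * (Complex.I * cis θ))‖ ≤
      C * K * √(1 - T) := by
    intro θ hθ
    have hseg : segment ℝ (cis θ) (T * cis θ) ⊆ annulus δ := by
      intro w hw
      rw [segment_eq_image] at hw
      obtain ⟨t, ht, rfl⟩ := hw
      have e : (1 - t) • cis θ + t • ((T : ℂ) * cis θ) = ((1 - t + t * T : ℝ) : ℂ) * cis θ := by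
        simp only [Complex.real_smul]
        push_cast
        ring
      have h1 : T ≤ 1 - t + t * T := by nlinarith [ht.1, ht.2]
      have h2 : 1 - t + t * T ≤ 1 := by nlinarith [ht.1, ht.2]
      have h3 := (hT θ).1.1
      rw [norm_ofReal_mul_cis hT0.le] at h3
      simp only [e]
      rw [annulus, mem_ofPred_eq, norm_ofReal_mul_cis (by linarith)]
      exact ⟨by linarith, by linarith⟩
    -- The mean value inequality on the radial segment gives `|Ψ| ≤ C (1 - T)`, against `K / √(1 -
    -- T)` for the form.
    have hmv : ‖Ψ (T * cis θ) - Ψ (cis θ)‖ ≤ C * ‖(T : ℂ) * cis θ - cis θ‖ :=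
      (convex_segment (𝕜 := ℝ) (cis θ) (T * cis θ)).norm_image_sub_le_of_norm_hasFDerivWithin_le
        (f' := fderiv ℝ Ψ)
        (fun w hw => (((hcont.differentiableOn (by norm_num)).differentiableAt
          ((isOpen_annulus δ).mem_nhds (hseg hw))).hasFDerivAt.hasFDerivWithinAt))
        (fun w hw => (hC w (hseg hw)).2) (left_mem_segment _ _ _) (right_mem_segment _ _ _)
    have hn : ‖(T : ℂ) * cis θ - cis θ‖ = 1 - T := by
      have : (T : ℂ) * cis θ - cis θ = ((T - 1 : ℝ) : ℂ) * cis θ := by push_cast; ring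
      rw [this, norm_mul, norm_cis, mul_one, Complex.norm_real, Real.norm_eq_abs,
        abs_of_neg (by linarith)]
      ring
    rw [h0 θ hθ, sub_zero, hn] at hmv
    have hb := (hK _ (hT θ).2).1
    rw [norm_ofReal_mul_cis hT0.le] at hb
    have hsq : √(1 - T) * √(1 - T) = 1 - T := Real.mul_self_sqrt (by linarith)
    have hsq0 : 0 < √(1 - T) := Real.sqrt_pos.2 (by linarith)
    have hv : ‖(T : ℂ) * (Complex.I * cis θ)‖ ≤ 1 := by
      rw [norm_mul, norm_mul, norm_cis, Complex.norm_I, Complex.norm_real,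
        Real.norm_of_nonneg hT0.le]
      linarith
    rw [fluxForm, smul_apply, norm_smul]
    calc _ ≤ C * (1 - T) * (K / √(1 - T) * 1) := by
          gcongr
          exact ContinuousLinearMap.le_of_opNorm_le_of_le _ hb hv
      _ = C * K * √(1 - T) * (√(1 - T) * √(1 - T) / (√(1 - T) * √(1 - T))) := by
          nth_rw 1 [← hsq]
          field_simp
      _ = _ := by rw [div_self (mul_pos hsq0 hsq0).ne', mul_one]
  -- The interval integral includes the endpoint `β`, where `Ψ` is not assumed to vanish; it is a
  -- null set.
  refine (intervalIntegral.norm_integral_le_of_norm_le_const_ae (C := C * K * √(1 - T))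
    ?_).trans (le_of_eq (by ring))
  filter_upwards [compl_mem_ae_iff.2 (measure_singleton (μ := volume) β)] with θ hθ hmem
  rw [uIoc_of_le hαβ] at hmem
  exact hpt θ ⟨hmem.1, hmem.2.lt_of_ne hθ⟩

/-! ### Arcs and angles -/

theorem cis_add (x y : ℝ) : cis (x + y) = cis x * cis y := by
  simp [cis, ← Complex.exp_add, add_mul]

theorem cis_periodic : Function.Periodic cis (2 * Real.pi) := fun θ => by
  rw [cis_add]
  simp [cis]

theorem cis_eq_cis_iff {x y : ℝ} : cis x = cis y ↔ ∃ n : ℤ, x = y + n * (2 * Real.pi) := by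
  rw [cis, cis, Complex.exp_eq_exp_iff_exists_int]
  refine exists_congr fun n => ⟨fun h => ?_, fun h => ?_⟩
  · have : ((x : ℂ) - (y + n * (2 * Real.pi))) * Complex.I = 0 := by linear_combination h
    rcases mul_eq_zero.1 this with h' | h'
    · exact_mod_cast sub_eq_zero.1 h'
    · exact absurd h' Complex.I_ne_zero
  · rw [h]
    push_cast
    ring

theorem eq_of_cis_eq {x y : ℝ} (h : cis x = cis y) (hxy : |x - y| < 2 * Real.pi) : x = y := by
  obtain ⟨n, hn⟩ := cis_eq_cis_iff.1 h
  have hpi := Real.two_pi_pos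
  have h1 : |(n : ℝ)| < 1 := by
    have : x - y = n * (2 * Real.pi) := by linarith
    rw [this, abs_mul, abs_of_pos hpi] at hxy
    nlinarith
  have h2 : n = 0 := by
    rw [← Int.abs_lt_one_iff]
    exact_mod_cast h1
  simpa [h2] using hn

theorem cis_arg {z : ℂ} (hz : ‖z‖ = 1) : cis z.arg = z := by
  have := Complex.norm_mul_exp_arg_mul_I z
  rwa [hz, Complex.ofReal_one, one_mul] at this

theorem arg_cis {θ : ℝ} (h : θ ∈ Ioc (-Real.pi) Real.pi) : (cis θ).arg = θ := by
  rw [cis, Complex.arg_exp_mul_I, toIocMod_eq_self]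
  simpa [two_mul] using h

theorem cis_ne_zero (θ : ℝ) : cis θ ≠ 0 := Complex.exp_ne_zero _

/-- `I` is, up to endpoints, the arc of the circle between the angles `α` and `β`. -/
structure IsArc (I : Set ℂ) (α β : ℝ) : Prop where
  le : α ≤ β
  le_add : β ≤ α + 2 * Real.pi
  image_subset : cis '' Ioo α β ⊆ I
  subset_image : I ⊆ cis '' Icc α β

/-- An angle function is continuous on the circle cut at a point outside `I`. The image of `I` is
then an interval, determined up to endpoints by its infimum and supremum. The empty set and the
whole circle are treated apart. -/
theorem exists_isArc {I : Set ℂ} (hI : I ⊆ circle) (hconn : IsPreconnected I) :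
    ∃ α β, IsArc I α β := by
  have hpi := Real.pi_pos
  have hnorm : ∀ z ∈ I, ‖z‖ = 1 := fun z hz => by simpa [circle] using hI hz
  rcases I.eq_empty_or_nonempty with rfl | hne
  · exact ⟨0, 0, le_rfl, by linarith, by simp, empty_subset _⟩
  by_cases hc : circle ⊆ I
  · refine ⟨-Real.pi, Real.pi, by linarith, by linarith, ?_, fun z hz => ?_⟩
    · rintro _ ⟨θ, -, rfl⟩
      exact hc (by simp [circle, norm_cis])
    · exact ⟨z.arg, ⟨(Complex.neg_pi_lt_arg z).le, Complex.arg_le_pi z⟩, cis_arg (hnorm z hz)⟩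
  obtain ⟨p, hp, hpI⟩ := not_subset.1 hc
  have hp1 : ‖p‖ = 1 := by simpa [circle] using hp
  have hp0 : p ≠ 0 := by
    rintro rfl
    simp at hp1
  -- The angle with values between `arg p` and `arg p + 2π`; the branch cut of `arg (-z / p)` is at
  -- `z = p`.
  set g : ℂ → ℝ := fun z => p.arg + Real.pi + (-z / p).arg with hg
  have hslit : ∀ z ∈ I, -z / p ∈ Complex.slitPlane := fun z hz => by
    have hn : ‖-z / p‖ = 1 := by rw [norm_div, norm_neg, hnorm z hz, hp1, div_one]
    refine Complex.mem_slitPlane_iff_arg.2 ⟨fun h => hpI ?_, fun h => by simp [h] at hn⟩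
    have := cis_arg hn
    rw [h] at this
    have hm : cis Real.pi = -1 := by simp [cis]
    rw [hm, eq_div_iff hp0, neg_one_mul, neg_inj] at this
    rwa [this]
  have hcis : ∀ z ∈ I, cis (g z) = z := fun z hz => by
    have hn : ‖-z / p‖ = 1 := by rw [norm_div, norm_neg, hnorm z hz, hp1, div_one]
    have hm : cis Real.pi = -1 := by simp [cis]
    rw [hg]
    simp only [cis_add, cis_arg hp1, cis_arg hn, hm]
    field_simp
  have hcont : ContinuousOn g I := fun z hz => by
    refine ContinuousAt.continuousWithinAt (continuousAt_const.add ?_)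
    exact (Complex.continuousAt_arg (hslit z hz)).comp (f := fun z => -z / p) (by fun_prop)
  have hconn' : IsConnected (g '' I) := ⟨hne.image g, hconn.image g hcont⟩
  have hsub : g '' I ⊆ Icc p.arg (p.arg + 2 * Real.pi) := by
    rintro _ ⟨z, -, rfl⟩
    exact ⟨by linarith [Complex.neg_pi_lt_arg (-z / p)], by linarith [Complex.arg_le_pi (-z / p)]⟩
  have hbb : BddBelow (g '' I) := bddBelow_Icc.mono hsub
  have hba : BddAbove (g '' I) := bddAbove_Icc.mono hsub
  have h1 : p.arg ≤ sInf (g '' I) := le_csInf hconn'.nonempty fun x hx => (hsub hx).1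
  have h2 : sSup (g '' I) ≤ p.arg + 2 * Real.pi :=
    csSup_le hconn'.nonempty fun x hx => (hsub hx).2
  refine ⟨sInf (g '' I), sSup (g '' I), csInf_le_csSup hconn'.nonempty hbb hba, by linarith, ?_, ?_⟩
  · rintro _ ⟨θ, hθ, rfl⟩
    obtain ⟨z, hz, rfl⟩ := hconn'.Ioo_csInf_csSup_subset hbb hba hθ
    rwa [hcis z hz]
  · intro z hz
    exact ⟨g z, ⟨csInf_le hbb ⟨z, hz, rfl⟩, le_csSup hba ⟨z, hz, rfl⟩⟩, hcis z hz⟩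

theorem countable_cis_eq (c : ℂ) : {θ : ℝ | cis θ = c}.Countable := by
  rcases {θ : ℝ | cis θ = c}.eq_empty_or_nonempty with h | ⟨y, hy⟩
  · rw [h]
    exact countable_empty
  · refine (countable_range fun n : ℤ => y + n * (2 * Real.pi)).mono fun x hx => ?_
    obtain ⟨n, hn⟩ := cis_eq_cis_iff.1 (show cis x = cis y from Eq.trans hx (Eq.symm hy))
    exact ⟨n, hn.symm⟩

/-- Extend the integrand by zero off the arc, periodically, and move the window from `(0, 2π]` to
`(α, α + 2π]`; endpoints are negligible. This permits angles `α`, `β` outside `[0, 2π]`. -/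
theorem IsArc.setIntegral_eq {I : Set ℂ} {α β : ℝ} (h : IsArc I α β) {g : ℝ → ℂ}
    (hg : Function.Periodic g (2 * Real.pi)) :
    ∫ θ in {θ : ℝ | θ ∈ Ioc 0 (2 * Real.pi) ∧ cis θ ∈ I}, g θ = ∫ θ in α..β, g θ := by
  have hpi := Real.two_pi_pos
  set A : Set ℝ := {θ | cis θ ∈ cis '' Icc α β} with hA
  have hAm : MeasurableSet A :=
    ((isCompact_Icc.image continuous_cis).isClosed.preimage continuous_cis).measurableSet
  have h1 : {θ : ℝ | θ ∈ Ioc 0 (2 * Real.pi) ∧ cis θ ∈ I} =ᵐ[volume]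
      (Ioc 0 (2 * Real.pi) ∩ A : Set ℝ) := by
    have hnull := ((countable_cis_eq (cis α)).union (countable_cis_eq (cis β))).ae_notMem volume
    filter_upwards [hnull] with θ hθ
    refine propext ⟨fun hx => ⟨hx.1, h.subset_image hx.2⟩, fun hx => ⟨hx.1, ?_⟩⟩
    obtain ⟨x, hx1, hx2⟩ := hx.2
    refine h.image_subset ⟨x, ⟨hx1.1.lt_of_ne ?_, hx1.2.lt_of_ne ?_⟩, hx2⟩
    · rintro rfl
      exact hθ (Or.inl hx2.symm)
    · rintro rfl
      exact hθ (Or.inr hx2.symm)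
  have h2 : (Ioc α (α + 2 * Real.pi) ∩ A : Set ℝ) =ᵐ[volume] Ioc α β := by
    filter_upwards [compl_mem_ae_iff.2 (measure_singleton (μ := volume) (α + 2 * Real.pi))]
      with θ hθ
    refine propext ⟨fun hx => ⟨hx.1.1, ?_⟩, fun hx => ⟨⟨hx.1, hx.2.trans h.le_add⟩,
      ⟨θ, Ioc_subset_Icc_self hx, rfl⟩⟩⟩
    obtain ⟨x, hx1, hx2⟩ := hx.2
    have hlt : θ < α + 2 * Real.pi := hx.1.2.lt_of_ne hθ
    have := eq_of_cis_eq hx2 (abs_lt.2 ⟨by linarith [hx1.1], by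
      linarith [hx1.2, h.le_add, hx.1.1]⟩)
    exact this ▸ hx1.2
  have hper : Function.Periodic (A.indicator g) (2 * Real.pi) := fun θ => by
    have : θ + 2 * Real.pi ∈ A ↔ θ ∈ A := by
      simp only [hA, mem_ofPred_eq, cis_periodic θ]
    by_cases hA' : θ ∈ A
    · rw [indicator_of_mem hA', indicator_of_mem (this.2 hA'), hg]
    · rw [indicator_of_notMem hA', indicator_of_notMem (mt this.1 hA')]
  rw [setIntegral_congr_set h1, ← setIntegral_indicator hAm, ← intervalIntegral.integral_of_le
    hpi.le, ← zero_add (2 * Real.pi), hper.intervalIntegral_add_eq 0 α,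
    intervalIntegral.integral_of_le (by linarith), setIntegral_indicator hAm,
    setIntegral_congr_set h2, intervalIntegral.integral_of_le h.le]

theorem arcIntegral_eq {I : Set ℂ} {α β : ℝ} (h : IsArc I α β) (f : ℂ → ℝ) (s : ℂ) (Ψ : ℂ → ℂ)
    (r : ℝ) :
    arcIntegral f s I Ψ r = 1 / normConst s * ∫ θ in α..β, arcIntegrand f s Ψ r θ := by
  have hper : Function.Periodic (arcIntegrand f s Ψ r) (2 * Real.pi) := fun θ => by
    have hpol : ∀ ρ, polar ρ (θ + 2 * Real.pi) = polar ρ θ := fun ρ => by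
      rw [polar, polar, cis_periodic θ]
    simp only [arcIntegrand, normalDeriv, hpol]
  rw [arcIntegral, ← h.setIntegral_eq hper]
  rfl

/-! ### Extension of test functions from an arc -/

theorem exists_contDiff_eqOn_Icc {h : ℝ → ℂ} {α β : ℝ} (hαβ : α < β)
    (hh : ContDiffOn ℝ 1 h (Icc α β)) : ∃ k : ℝ → ℂ, ContDiff ℝ 1 k ∧ EqOn k h (Icc α β) := by
  have hc : ContinuousOn (derivWithin h (Icc α β)) (Icc α β) :=
    hh.continuousOn_derivWithin (uniqueDiffOn_Icc hαβ) le_rfl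
  -- The extension is a primitive of the one-sided derivative, continued by its endpoint values.
  set d : ℝ → ℂ := IccExtend hαβ.le ((Icc α β).domRestrict (derivWithin h (Icc α β))) with hd
  have hdc : Continuous d := (continuousOn_iff_continuous_domRestrict.1 hc).Icc_extend'
  have hk : ∀ x, HasDerivAt (fun x => h α + ∫ t in α..x, d t) (d x) x := fun x =>
    (hdc.integral_hasStrictDerivAt α x).hasDerivAt.const_add _
  refine ⟨fun x => h α + ∫ t in α..x, d t, ?_, fun x hx => ?_⟩
  · refine contDiff_one_iff_deriv.2 ⟨fun x => (hk x).differentiableAt, ?_⟩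
    rwa [funext fun x => (hk x).deriv]
  · have := intervalIntegral.integral_eq_sub_of_hasDerivAt_of_le hx.1 (f := h) (f' := d)
      (hh.continuousOn.mono (Icc_subset_Icc_right hx.2)) (fun t ht => ?_)
      (hdc.intervalIntegrable _ _)
    · simp only [this]
      ring
    · have ht' : t ∈ Ioo α β := ⟨ht.1, ht.2.trans_le hx.2⟩
      have h1 := ((hh.differentiableOn (by norm_num)) t (Ioo_subset_Icc_self ht')
        ).hasDerivWithinAt.hasDerivAt (Icc_mem_nhds ht'.1 ht'.2)
      rwa [hd, IccExtend_of_mem _ _ (Ioo_subset_Icc_self ht')]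

theorem contDiffAt_arg_div {z p : ℂ} (h : z / p ∈ Complex.slitPlane) :
    ContDiffAt ℝ 1 (fun z : ℂ => (z / p).arg) z := by
  have h1 : ContDiffAt ℝ 1 Complex.log (z / p) := (Complex.contDiffAt_log h).restrict_scalars ℝ
  have h2 : ContDiffAt ℝ 1 (fun z : ℂ => z / p) z := contDiffAt_id.mul contDiffAt_const
  exact (Complex.imCLM.contDiff.contDiffAt.comp _ (h1.comp z h2)).congr_of_eventuallyEq
    (.of_forall fun w => (Complex.log_im _).symm)

theorem isC1NearCircle_of_contDiffAt {Ψ : ℂ → ℂ} (h : ∀ z ∈ circle, ContDiffAt ℝ 1 Ψ z) :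
    IsC1NearCircle Ψ := by
  choose! u hu hΨ using fun z hz => (h z hz).contDiffOn le_rfl (by simp)
  refine ⟨⋃ z ∈ circle, interior (u z), isOpen_biUnion fun z _ => isOpen_interior, fun z hz => ?_,
    fun w hw => ?_⟩
  · exact mem_biUnion hz (mem_interior_iff_mem_nhds.2 (hu z hz))
  · simp only [mem_iUnion] at hw
    obtain ⟨z, hz, hw⟩ := hw
    exact ((hΨ z hz).contDiffAt (mem_interior_iff_mem_nhds.1 hw)).contDiffWithinAt

/-- Near each `z` the angle has a smooth local branch, and the choice of branch is immaterial
because `ψ ∘ cis` is `C¹` on the whole line. -/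
theorem isC1NearCircle_radial {ψ : ℂ → ℂ} (h : ContDiff ℝ 1 fun θ : ℝ => ψ (cis θ)) :
    IsC1NearCircle fun z => ψ (z / ‖z‖) := by
  refine isC1NearCircle_of_contDiffAt fun z hz => ?_
  have hz1 : ‖z‖ = 1 := by simpa [circle] using hz
  have hz0 : z ≠ 0 := by
    rintro rfl
    simp at hz1
  have h1 : ContDiffAt ℝ 1 (fun w : ℂ => ψ (cis (z.arg + (w / z).arg))) z :=
    h.contDiffAt.comp z (f := fun w : ℂ => z.arg + (w / z).arg)
      (contDiffAt_const.add (contDiffAt_arg_div (by rw [div_self hz0]; simp)))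
  refine h1.congr_of_eventuallyEq ?_
  filter_upwards [isOpen_ne.mem_nhds hz0] with w hw
  have e : cis (w / z).arg = w / z / ‖w‖ := by
    have := Complex.norm_mul_exp_arg_mul_I (w / z)
    rw [norm_div, hz1, div_one] at this
    rw [eq_div_iff (by simpa using hw), mul_comm]
    exact this
  rw [cis_add, cis_arg hz1, e]
  congr 1
  field_simp

/-- A proper closed arc misses the point opposite its midpoint. Centre the argument at the midpoint
and cut off before its jump there. -/
theorem exists_isC1NearCircle_of_lt {k : ℝ → ℂ} (hk : ContDiff ℝ 1 k) {α β : ℝ} (hαβ : α ≤ β)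
    (hlt : β < α + 2 * Real.pi) :
    ∃ Ψ, IsC1NearCircle Ψ ∧ ∀ θ ∈ Icc α β, Ψ (cis θ) = k θ := by
  have hpi := Real.pi_pos
  set m := (α + β) / 2 with hm
  set ρ := (β - α) / 2 with hρ
  have hρ0 : 0 ≤ ρ := by linarith
  have hρ1 : ρ < Real.pi := by linarith
  -- The radii trisect `[ρ, π]`: the bump is `1` on the arc and vanishes before the cut.
  let χ : ContDiffBump (0 : ℝ) := ⟨(2 * ρ + Real.pi) / 3, (ρ + 2 * Real.pi) / 3, by linarith,
    by linarith⟩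
  set q := cis m with hq
  have hq0 : q ≠ 0 := cis_ne_zero m
  refine ⟨fun z => (χ (z / q).arg : ℂ) * k (m + (z / q).arg), ?_, fun θ hθ => ?_⟩
  · refine isC1NearCircle_of_contDiffAt fun z hz => ?_
    have hz1 : ‖z‖ = 1 := by simpa [circle] using hz
    have hz0 : z ≠ 0 := by
      rintro rfl
      simp at hz1
    by_cases hs : z / q ∈ Complex.slitPlane
    · have ha := contDiffAt_arg_div hs
      exact (Complex.ofRealCLM.contDiff.contDiffAt.comp z (χ.contDiff.contDiffAt.comp z ha)).mul
        (hk.contDiffAt.comp z (f := fun w : ℂ => m + (w / q).arg) (contDiffAt_const.add ha))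
    · have harg : (z / q).arg = Real.pi := by
        by_contra hne
        exact hs (Complex.mem_slitPlane_iff_arg.2 ⟨hne, div_ne_zero hz0 hq0⟩)
      -- The argument jumps at the cut but its cosine is continuous, which keeps nearby arguments
      -- outside the support of the bump.
      have hcos : ∀ w : ℂ, w ≠ 0 → Real.cos (w / q).arg = (w / q).re / ‖w / q‖ := fun w hw =>
        Complex.cos_arg (div_ne_zero hw hq0)
      have hlim : ContinuousAt (fun w : ℂ => (w / q).re / ‖w / q‖) z := by
        refine ContinuousAt.div ?_ ?_ (norm_ne_zero_iff.2 (div_ne_zero hz0 hq0))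
        · exact Complex.continuous_re.continuousAt.comp (f := fun w => w / q) (by fun_prop)
        · fun_prop
      have hval : (z / q).re / ‖z / q‖ < Real.cos χ.rOut := by
        rw [← hcos z hz0, harg]
        exact Real.cos_lt_cos_of_nonneg_of_le_pi χ.rOut_pos.le le_rfl
          (show (ρ + 2 * Real.pi) / 3 < Real.pi by linarith)
      refine contDiffAt_const (c := (0 : ℂ)) |>.congr_of_eventuallyEq ?_
      filter_upwards [isOpen_ne.mem_nhds hz0, hlim.eventually (gt_mem_nhds hval)] with w hw hw'
      rw [← hcos w hw] at hw'
      have : χ.rOut ≤ dist (w / q).arg 0 := by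
        rw [Real.dist_eq, sub_zero]
        by_contra! hlt
        rw [← Real.cos_abs] at hw'
        exact absurd hw' (not_lt.2 (Real.cos_le_cos_of_nonneg_of_le_pi (abs_nonneg _)
          (show (ρ + 2 * Real.pi) / 3 ≤ Real.pi by linarith) hlt.le))
      rw [χ.zero_of_le_dist this]
      simp
  · have e : cis θ / q = cis (θ - m) := by
      rw [div_eq_iff hq0, hq, ← cis_add, sub_add_cancel]
    have hr : |θ - m| ≤ ρ := abs_le.2 ⟨by linarith [hθ.1], by linarith [hθ.2]⟩
    have ha : (cis θ / q).arg = θ - m := by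
      rw [e, arg_cis ⟨by linarith [neg_abs_le (θ - m)], by linarith [le_abs_self (θ - m)]⟩]
    have h1 : χ (θ - m) = 1 := χ.one_of_mem_closedBall (by
      rw [mem_closedBall_zero_iff, Real.norm_eq_abs]
      exact hr.trans (show ρ ≤ (2 * ρ + Real.pi) / 3 by linarith))
    simp [ha, h1]

/-- Three cases: at most one point (a constant), length `2π` (the closure of `I` is the circle, so
extend radially), and a proper arc (extend in the angle, then cut off). -/
theorem IsArc.exists_isC1NearCircle {I : Set ℂ} {α β : ℝ} (h : IsArc I α β) {ψ : ℂ → ℂ}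
    (hψ : IsC1OnClosure I ψ) : ∃ Ψ, IsC1NearCircle Ψ ∧ EqOn Ψ ψ I := by
  rcases h.le.eq_or_lt with heq | hlt
  · subst heq
    refine ⟨fun _ => ψ (cis α), isC1NearCircle_of_contDiffAt fun z _ => contDiffAt_const,
      fun z hz => ?_⟩
    obtain ⟨θ, hθ, rfl⟩ := h.subset_image hz
    rw [Icc_self, mem_singleton_iff] at hθ
    rw [hθ]
  have hcl : ∀ θ ∈ Icc α β, cis θ ∈ closure I := fun θ hθ => by
    rw [← closure_Ioo hlt.ne] at hθ
    exact closure_mono h.image_subset (image_closure_subset_closure_image continuous_cis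
      ⟨θ, hθ, rfl⟩)
  rcases h.le_add.eq_or_lt with heq | hlt'
  · have hall : ∀ θ, cis θ ∈ closure I := fun θ => by
      obtain ⟨y, hy, hy'⟩ := cis_periodic.exists_mem_Ico Real.two_pi_pos θ α
      rw [hy']
      exact hcl y ⟨hy.1, by linarith [hy.2]⟩
    refine ⟨fun z => ψ (z / ‖z‖), isC1NearCircle_radial ?_, fun z hz => ?_⟩
    · rw [← contDiffOn_univ]
      exact hψ.mono fun θ _ => hall θ
    · obtain ⟨θ, -, rfl⟩ := h.subset_image hz
      simp [norm_cis]
  · obtain ⟨k, hk, hkeq⟩ := exists_contDiff_eqOn_Icc hlt (hψ.mono hcl)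
    obtain ⟨Ψ, hΨ, hΨeq⟩ := exists_isC1NearCircle_of_lt hk hlt.le hlt'
    refine ⟨Ψ, hΨ, fun z hz => ?_⟩
    obtain ⟨θ, hθ, rfl⟩ := h.subset_image hz
    rw [hΨeq θ hθ, hkeq hθ]

/-! ### Möbius maps and conformal covariance -/

namespace DiskMobius

variable (γ : DiskMobius)

/-- The denominator of a Möbius transformation. -/
noncomputable def den (z : ℂ) : ℂ := (starRingEnd ℂ) γ.b * z + (starRingEnd ℂ) γ.a

theorem map_eq (z : ℂ) : γ.map z = (γ.a * z + γ.b) / γ.den z := rfl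

theorem norm_b_lt : ‖γ.b‖ < ‖γ.a‖ :=
  lt_of_pow_lt_pow_left₀ 2 (norm_nonneg _) (by linarith [γ.norm_sq_sub])

theorem one_le_norm_a : 1 ≤ ‖γ.a‖ := by
  nlinarith [γ.norm_sq_sub, norm_nonneg γ.a, sq_nonneg ‖γ.b‖]

theorem le_norm_den {z : ℂ} (hz : ‖z‖ ≤ 1) : ‖γ.a‖ - ‖γ.b‖ ≤ ‖γ.den z‖ := by
  have h := norm_sub_le_norm_add ((starRingEnd ℂ) γ.a) ((starRingEnd ℂ) γ.b * z)
  rw [norm_mul, RCLike.norm_conj, RCLike.norm_conj, add_comm] at h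
  have : ‖γ.b‖ * ‖z‖ ≤ ‖γ.b‖ := mul_le_of_le_one_right (norm_nonneg _) hz
  exact le_trans (by linarith) h

theorem norm_den_le {z : ℂ} (hz : ‖z‖ ≤ 1) : ‖γ.den z‖ ≤ ‖γ.a‖ + ‖γ.b‖ := by
  refine (norm_add_le _ _).trans ?_
  rw [norm_mul, RCLike.norm_conj, RCLike.norm_conj]
  have : ‖γ.b‖ * ‖z‖ ≤ ‖γ.b‖ := mul_le_of_le_one_right (norm_nonneg _) hz
  linarith

theorem norm_den_pos {z : ℂ} (hz : ‖z‖ ≤ 1) : 0 < ‖γ.den z‖ :=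
  (sub_pos.2 γ.norm_b_lt).trans_le (γ.le_norm_den hz)

theorem den_ne_zero {z : ℂ} (hz : ‖z‖ ≤ 1) : γ.den z ≠ 0 := norm_pos_iff.1 (γ.norm_den_pos hz)

theorem a_mul_conj_sub : γ.a * (starRingEnd ℂ) γ.a - γ.b * (starRingEnd ℂ) γ.b = 1 := by
  rw [Complex.mul_conj', Complex.mul_conj']
  exact_mod_cast γ.norm_sq_sub

theorem hasDerivAt_map {z : ℂ} (hz : γ.den z ≠ 0) : HasDerivAt γ.map (1 / γ.den z ^ 2) z := by
  have h1 : HasDerivAt (fun z => γ.a * z + γ.b) γ.a z := by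
    simpa using ((hasDerivAt_id z).const_mul γ.a).add_const γ.b
  have h2 : HasDerivAt γ.den ((starRingEnd ℂ) γ.b) z := by
    exact (((hasDerivAt_id z).const_mul ((starRingEnd ℂ) γ.b)).add_const
      ((starRingEnd ℂ) γ.a)).congr_deriv (mul_one _)
  refine (h1.div h2 hz).congr_deriv ?_
  congr 1
  rw [den]
  linear_combination γ.a_mul_conj_sub

theorem normSq_den_sub (z : ℂ) :
    ‖γ.den z‖ ^ 2 - ‖γ.a * z + γ.b‖ ^ 2 = 1 - ‖z‖ ^ 2 := by
  have h : ((‖γ.den z‖ ^ 2 - ‖γ.a * z + γ.b‖ ^ 2 : ℝ) : ℂ) = ((1 - ‖z‖ ^ 2 : ℝ) : ℂ) := by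
    push_cast
    rw [← Complex.mul_conj', ← Complex.mul_conj', ← Complex.mul_conj', den]
    simp only [map_add, map_mul, Complex.conj_conj]
    linear_combination (1 - z * (starRingEnd ℂ) z) * γ.a_mul_conj_sub
  exact_mod_cast h

theorem one_sub_norm_map_sq {z : ℂ} (hz : γ.den z ≠ 0) :
    1 - ‖γ.map z‖ ^ 2 = (1 - ‖z‖ ^ 2) / ‖γ.den z‖ ^ 2 := by
  have h : ‖γ.den z‖ ≠ 0 := norm_ne_zero_iff.2 hz
  rw [map_eq, norm_div, ← γ.normSq_den_sub z]
  field_simp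

theorem norm_map_of_norm_eq_one {z : ℂ} (hz : ‖z‖ = 1) : ‖γ.map z‖ = 1 := by
  have h := γ.one_sub_norm_map_sq (γ.den_ne_zero hz.le)
  rw [hz] at h
  have h1 : ‖γ.map z‖ ^ 2 = 1 := by simp at h; linarith
  exact (pow_eq_one_iff_of_nonneg (norm_nonneg _) two_ne_zero).1 h1

theorem map_mem_disk {z : ℂ} (hz : z ∈ disk) : γ.map z ∈ disk := by
  have hz1 : ‖z‖ < 1 := by simpa [disk] using hz
  have h := γ.one_sub_norm_map_sq (γ.den_ne_zero hz1.le)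
  have h1 : 0 < (1 - ‖z‖ ^ 2) / ‖γ.den z‖ ^ 2 :=
    div_pos (one_sub_sq_pos hz) (pow_pos (γ.norm_den_pos hz1.le) 2)
  rw [disk, mem_ball_zero_iff]
  nlinarith [norm_nonneg (γ.map z)]

theorem inv_map_map {z : ℂ} (hz : γ.den z ≠ 0) : γ.inv.map (γ.map z) = z := by
  have h1 : γ.inv.den (γ.map z) = 1 / γ.den z := by
    rw [den, map_eq, inv]
    simp only [map_neg, Complex.conj_conj]
    rw [eq_div_iff hz, add_mul, mul_assoc, div_mul_cancel₀ _ hz, den]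
    linear_combination γ.a_mul_conj_sub
  rw [map_eq, h1, div_div_eq_mul_div, div_one, map_eq, inv, add_mul, mul_assoc,
    div_mul_cancel₀ _ hz, den]
  linear_combination z * γ.a_mul_conj_sub

theorem map_sub_map {z w : ℂ} (hz : γ.den z ≠ 0) (hw : γ.den w ≠ 0) :
    γ.map z - γ.map w = (z - w) / (γ.den z * γ.den w) := by
  rw [map_eq, map_eq, div_sub_div _ _ hz hw]
  congr 1
  rw [den, den]
  linear_combination (z - w) * γ.a_mul_conj_sub

theorem norm_deriv_map {z : ℂ} (hz : γ.den z ≠ 0) : ‖deriv γ.map z‖ = (‖γ.den z‖ ^ 2)⁻¹ := by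
  rw [(γ.hasDerivAt_map hz).deriv]
  simp

/-- The conformal factor `|γ'|^s`. -/
noncomputable def factor (s z : ℂ) : ℂ := Complex.exp (-(2 * s) * (Real.log ‖γ.den z‖ : ℂ))

theorem norm_deriv_map_cpow {z : ℂ} (hz : γ.den z ≠ 0) (s : ℂ) :
    ((‖deriv γ.map z‖ : ℝ) : ℂ) ^ s = γ.factor s z := by
  have h : 0 < ‖γ.den z‖ := norm_pos_iff.2 hz
  have h' : 0 < (‖γ.den z‖ ^ 2)⁻¹ := by positivity
  rw [γ.norm_deriv_map hz, Complex.cpow_def_of_ne_zero (Complex.ofReal_ne_zero.2 h'.ne'),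
    ← Complex.ofReal_log h'.le, Real.log_inv, Real.log_pow, factor]
  congr 1
  push_cast
  ring

theorem factor_ne_zero (s z : ℂ) : γ.factor s z ≠ 0 := Complex.exp_ne_zero _

theorem weight_map {z : ℂ} (hz : z ∈ disk) (s : ℂ) :
    weight s (γ.map z) = weight s z * γ.factor s z := by
  have hz1 : ‖z‖ ≤ 1 := by
    have : ‖z‖ < 1 := by simpa [disk] using hz
    exact this.le
  rw [weight, weight, factor, γ.one_sub_norm_map_sq (γ.den_ne_zero hz1), ← Complex.exp_add,
    Real.log_div (one_sub_sq_pos hz).ne' (pow_pos (γ.norm_den_pos hz1) 2).ne', Real.log_pow]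
  congr 1
  push_cast
  ring

theorem contDiffAt_map {n : WithTop ℕ∞} {z : ℂ} (hz : γ.den z ≠ 0) :
    ContDiffAt ℝ n γ.map z := by
  have h1 : ContDiffAt ℝ n (fun z : ℂ => γ.a * z + γ.b) z := by fun_prop
  have h2 : ContDiffAt ℝ n γ.den z := by
    unfold den
    fun_prop
  exact h1.mul (h2.inv hz)

theorem contDiffAt_factor {z : ℂ} (hz : γ.den z ≠ 0) (s : ℂ) :
    ContDiffAt ℝ 1 (γ.factor s) z := by
  have h2 : ContDiffAt ℝ 1 γ.den z := by
    unfold den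
    fun_prop
  exact (contDiffAt_const.mul (Complex.ofRealCLM.contDiff.contDiffAt.comp z
    ((h2.norm ℝ hz).log (norm_ne_zero_iff.2 hz)))).cexp

/-- The pull-back of a test function on the circle, weighted by `|γ'|^s`. -/
noncomputable def pullback (s : ℂ) (Ψ : ℂ → ℂ) (z : ℂ) : ℂ := Ψ (γ.map z) * γ.factor s z

theorem isC1NearCircle_pullback {Ψ : ℂ → ℂ} (hΨ : IsC1NearCircle Ψ) (s : ℂ) :
    IsC1NearCircle (γ.pullback s Ψ) := by
  obtain ⟨U, hU, hcU, hΨU⟩ := hΨ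
  refine isC1NearCircle_of_contDiffAt fun z hz => ?_
  have hz1 : ‖z‖ = 1 := by simpa [circle] using hz
  have hd := γ.den_ne_zero hz1.le
  have hm : γ.map z ∈ circle := by simpa [circle] using γ.norm_map_of_norm_eq_one hz1
  exact ((hΨU.contDiffAt (hU.mem_nhds (hcU hm))).comp z (γ.contDiffAt_map hd)).mul
    (γ.contDiffAt_factor hd s)

theorem fderiv_map_apply {f : ℂ → ℝ} (hf : ContDiffOn ℝ 2 f disk)
    (hγ : ∀ z ∈ disk, f (γ.map z) = f z) {z : ℂ} (hz : z ∈ disk) (v : ℂ) :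
    fderiv ℝ f (γ.map z) (1 / γ.den z ^ 2 * v) = fderiv ℝ f z v := by
  have hz1 : ‖z‖ < 1 := by simpa [disk] using hz
  have h1 : HasFDerivAt f (fderiv ℝ f (γ.map z)) (γ.map z) :=
    ((hf.contDiffAt (isOpen_disk.mem_nhds (γ.map_mem_disk hz))).differentiableAt
      (by norm_num)).hasFDerivAt
  have h2 := h1.comp z ((γ.hasDerivAt_map (γ.den_ne_zero hz1.le)).hasFDerivAt.restrictScalars ℝ)
  have h3 : (f ∘ γ.map) =ᶠ[𝓝 z] f := by
    filter_upwards [isOpen_disk.mem_nhds hz] with w hw using hγ w hw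
  rw [← h3.fderiv_eq, h2.fderiv]
  simp [mul_comm]

/-- Conformal covariance of `fluxForm`, up to a term of order zero. -/
theorem fluxForm_map {f : ℂ → ℝ} (hf : ContDiffOn ℝ 2 f disk)
    (hγ : ∀ z ∈ disk, f (γ.map z) = f z) (s : ℂ) (Ψ : ℂ → ℂ) {z : ℂ} (hz : z ∈ disk) (v : ℂ) :
    fluxForm f s Ψ (γ.map z) (1 / γ.den z ^ 2 * v) = fluxForm f s (γ.pullback s Ψ) z v +
      2 * s * (((starRingEnd ℂ) γ.b * v / γ.den z).im : ℝ) *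
        (γ.pullback s Ψ z * (weight s z * f z)) := by
  have hz1 : ‖z‖ < 1 := by simpa [disk] using hz
  have hd := γ.den_ne_zero hz1.le
  have hdn := γ.norm_den_pos hz1.le
  have hy := one_sub_sq_pos hz
  have h1 : -Complex.I * (1 / γ.den z ^ 2 * v) = 1 / γ.den z ^ 2 * (-Complex.I * v) := by ring
  -- This is `log (1 - |γ z|²) = log (1 - |z|²) - 2 log |γ.den z|`, differentiated along `-i v`; the
  -- last term produces the zeroth order correction.
  have h2 : ((starRingEnd ℂ) (γ.map z) * (1 / γ.den z ^ 2 * v)).im =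
      (((starRingEnd ℂ) z * v).im + (1 - ‖z‖ ^ 2) * ((starRingEnd ℂ) γ.b * v / γ.den z).im) /
        ‖γ.den z‖ ^ 2 := by
    have hc : (starRingEnd ℂ) (γ.den z) ≠ 0 := by simpa using hd
    have e : (starRingEnd ℂ) (γ.map z) * (1 / γ.den z ^ 2 * v) * ((‖γ.den z‖ ^ 2 : ℝ) : ℂ) =
        (starRingEnd ℂ) z * v +
          ((1 - ‖z‖ ^ 2 : ℝ) : ℂ) * ((starRingEnd ℂ) γ.b * v / γ.den z) := by
      push_cast
      rw [← Complex.mul_conj', ← Complex.mul_conj', map_eq, map_div₀]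
      field_simp
      rw [den]
      simp only [map_add, map_mul]
      ring
    rw [eq_div_iff (pow_pos hdn 2).ne', ← Complex.im_mul_ofReal, e, Complex.add_im,
      Complex.im_ofReal_mul]
  rw [fluxForm, fluxForm, smul_apply, smul_apply, baseForm_apply, baseForm_apply, h1,
    γ.fderiv_map_apply hf hγ hz, γ.weight_map hz, h2, hγ z hz,
    γ.one_sub_norm_map_sq hd, pullback, smul_eq_mul, smul_eq_mul]
  have c1 : ((1 - ‖z‖ ^ 2 : ℝ) : ℂ) ≠ 0 := Complex.ofReal_ne_zero.2 hy.ne'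
  have c2 : ((‖γ.den z‖ ^ 2 : ℝ) : ℂ) ≠ 0 := Complex.ofReal_ne_zero.2 (pow_pos hdn 2).ne'
  rw [Complex.ofReal_div, Complex.ofReal_div, Complex.ofReal_add, Complex.ofReal_mul]
  generalize ((1 - ‖z‖ ^ 2 : ℝ) : ℂ) = y at c1 ⊢
  generalize ((‖γ.den z‖ ^ 2 : ℝ) : ℂ) = n at c2 ⊢
  field_simp
  ring

/-! ### The boundary action in the angular variable -/

/-- A lift of the action on the circle to the angular variable. -/
noncomputable def lift (θ : ℝ) : ℝ :=
  (γ.map (cis 0)).arg + ∫ t in (0 : ℝ)..θ, (‖γ.den (cis t)‖ ^ 2)⁻¹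

theorem continuous_norm_den_cis : Continuous fun t : ℝ => (‖γ.den (cis t)‖ ^ 2)⁻¹ := by
  have hc := continuous_cis
  unfold den
  refine Continuous.inv₀ (by fun_prop) fun t => ?_
  exact (pow_pos (γ.norm_den_pos (norm_cis t).le) 2).ne'

theorem hasDerivAt_lift (θ : ℝ) : HasDerivAt γ.lift (‖γ.den (cis θ)‖ ^ 2)⁻¹ θ :=
  (γ.continuous_norm_den_cis.integral_hasStrictDerivAt 0 θ).hasDerivAt.const_add _

theorem strictMono_lift : StrictMono γ.lift := by
  refine strictMono_of_deriv_pos fun θ => ?_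
  rw [(γ.hasDerivAt_lift θ).deriv]
  exact inv_pos.2 (pow_pos (γ.norm_den_pos (norm_cis θ).le) 2)

theorem continuous_lift : Continuous γ.lift :=
  continuous_iff_continuousAt.2 fun θ => (γ.hasDerivAt_lift θ).continuousAt

/-- On the circle `γ'` carries the outward normal at `z` to a positive multiple of the outward
normal at `γ z`. -/
theorem deriv_mul_eq {z : ℂ} (hz : ‖z‖ = 1) :
    1 / γ.den z ^ 2 * z = ((‖γ.den z‖ ^ 2)⁻¹ : ℝ) * γ.map z := by
  have hd := γ.den_ne_zero hz.le
  have hc : (starRingEnd ℂ) (γ.den z) ≠ 0 := by simpa using hd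
  have h1 := Complex.mul_conj' z
  rw [hz] at h1
  push_cast at h1 ⊢
  rw [← Complex.mul_conj', map_eq]
  field_simp
  rw [den]
  simp only [map_add, map_mul, Complex.conj_conj]
  linear_combination γ.b * h1

theorem hasDerivAt_map_mul_cis {T : ℝ} (hT0 : 0 ≤ T) (hT : T ≤ 1) (θ : ℝ) :
    HasDerivAt (fun θ : ℝ => γ.map (T * cis θ))
      (1 / γ.den (T * cis θ) ^ 2 * (T * (Complex.I * cis θ))) θ := by
  have hd : γ.den (T * cis θ) ≠ 0 := γ.den_ne_zero (by rwa [norm_ofReal_mul_cis hT0])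
  have h := (γ.hasDerivAt_map hd).scomp θ ((hasDerivAt_cis θ).const_mul (T : ℂ))
  refine h.congr_deriv ?_
  rw [smul_eq_mul, mul_comm]

/-- Both sides solve the linear equation `u' = i |γ'(e^{iθ})| u` with the same value at `0`. The
proof shows that the right side times the inverse of the left is constant. -/
theorem cis_lift (θ : ℝ) : cis (γ.lift θ) = γ.map (cis θ) := by
  have h1 : ∀ θ, HasDerivAt (fun θ => γ.map (cis θ))
      (Complex.I * (((‖γ.den (cis θ)‖ ^ 2)⁻¹ : ℝ) * γ.map (cis θ))) θ := fun θ => by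
    have := γ.hasDerivAt_map_mul_cis zero_le_one le_rfl θ
    simp only [Complex.ofReal_one, one_mul] at this
    refine this.congr_deriv ?_
    rw [← γ.deriv_mul_eq (norm_cis θ)]
    ring
  have h2 : ∀ θ, HasDerivAt (fun θ => cis (-γ.lift θ))
      (-(((‖γ.den (cis θ)‖ ^ 2)⁻¹ : ℝ) * (Complex.I * cis (-γ.lift θ)))) θ := fun θ => by
    refine ((hasDerivAt_cis (-γ.lift θ)).scomp θ (γ.hasDerivAt_lift θ).neg).congr_deriv ?_
    rw [Complex.real_smul]
    push_cast
    ring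
  have h3 : ∀ θ, HasDerivAt (fun θ => γ.map (cis θ) * cis (-γ.lift θ)) 0 θ := fun θ => by
    refine ((h1 θ).mul (h2 θ)).congr_deriv ?_
    ring
  have h4 := is_const_of_deriv_eq_zero (fun θ => (h3 θ).differentiableAt)
    (fun θ => (h3 θ).deriv) θ 0
  have h5 : ∀ x : ℝ, cis x * cis (-x) = 1 := fun x => by rw [← cis_add]; simp [cis]
  have h6 : cis (γ.lift 0) = γ.map (cis 0) := by
    rw [lift, intervalIntegral.integral_same, add_zero,
      cis_arg (γ.norm_map_of_norm_eq_one (norm_cis 0))]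
  rw [← h6, h5] at h4
  calc cis (γ.lift θ) = cis (γ.lift θ) * (γ.map (cis θ) * cis (-γ.lift θ)) := by rw [h4, mul_one]
    _ = γ.map (cis θ) * (cis (γ.lift θ) * cis (-γ.lift θ)) := by ring
    _ = _ := by rw [h5, mul_one]

/-- The lift is continuous and increasing, so it maps intervals onto intervals. A length beyond `2π`
would make `γ` identify two distinct points of the circle. -/
theorem isArc_image {I : Set ℂ} {α β : ℝ} (h : IsArc I α β) :
    IsArc (γ.map '' I) (γ.lift α) (γ.lift β) := by
  refine ⟨γ.strictMono_lift.monotone h.le, ?_, ?_, ?_⟩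
  · by_contra! hlt
    obtain ⟨θ, hθ, heq⟩ := intermediate_value_Ioo h.le γ.continuous_lift.continuousOn
      (⟨by linarith [Real.two_pi_pos], hlt⟩ : γ.lift α + 2 * Real.pi ∈ Ioo (γ.lift α) (γ.lift β))
    have h1 : γ.map (cis θ) = γ.map (cis α) := by
      rw [← cis_lift, ← cis_lift, heq, cis_periodic]
    have h2 := congrArg γ.inv.map h1
    rw [γ.inv_map_map (γ.den_ne_zero (norm_cis θ).le),
      γ.inv_map_map (γ.den_ne_zero (norm_cis α).le)] at h2
    have := eq_of_cis_eq h2 (abs_lt.2 ⟨by linarith [hθ.1, Real.two_pi_pos], by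
      linarith [hθ.2, h.le_add]⟩)
    linarith [hθ.1]
  · rintro _ ⟨y, hy, rfl⟩
    obtain ⟨θ, hθ, rfl⟩ := intermediate_value_Ioo h.le γ.continuous_lift.continuousOn hy
    exact ⟨cis θ, h.image_subset ⟨θ, hθ, rfl⟩, (γ.cis_lift θ).symm⟩
  · rintro _ ⟨z, hz, rfl⟩
    obtain ⟨θ, hθ, rfl⟩ := h.subset_image hz
    exact ⟨γ.lift θ, ⟨γ.strictMono_lift.monotone hθ.1, γ.strictMono_lift.monotone hθ.2⟩,
      γ.cis_lift θ⟩

end DiskMobius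

/-! ### Equivariance of the flux -/

namespace DiskMobius

variable (γ : DiskMobius)

theorem contDiff_map_mul_cis {n : WithTop ℕ∞} {T : ℝ} (hT0 : 0 ≤ T) (hT : T ≤ 1) :
    ContDiff ℝ n fun θ : ℝ => γ.map (T * cis θ) :=
  contDiff_iff_contDiffAt.2 fun θ =>
    (γ.contDiffAt_map (γ.den_ne_zero (by rwa [norm_ofReal_mul_cis hT0]))).comp θ
      (f := fun θ : ℝ => (T : ℂ) * cis θ) (contDiff_const.mul contDiff_cis).contDiffAt

/-- The flux through the arc `γ I` of a circle, as an integral over the angles of `I`. -/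
theorem flux_lift {f : ℂ → ℝ} (hf : ContDiffOn ℝ 2 f disk) (s : ℂ) {Ψ : ℂ → ℂ}
    (hΨ : IsC1NearCircle Ψ) (α β : ℝ) :
    ∀ᶠ T : ℝ in 𝓝[<] 1, flux f s Ψ (γ.lift α) (γ.lift β) T =
      ∫ θ in α..β, fluxForm f s Ψ (T * γ.map (cis θ))
        (T * (1 / γ.den (cis θ) ^ 2 * (Complex.I * cis θ))) := by
  filter_upwards [eventually_continuous_fluxForm hf s hΨ] with T hT
  -- Change of variables by the lift, whose derivative is the density `|γ'|` on the circle.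
  rw [flux, ← intervalIntegral.integral_deriv_smul_comp (fun θ _ => γ.hasDerivAt_lift θ)
    γ.continuous_norm_den_cis.continuousOn hT]
  refine intervalIntegral.integral_congr fun θ _ => ?_
  simp only [Function.comp, γ.cis_lift]
  rw [← map_smul]
  congr 1
  have := γ.deriv_mul_eq (norm_cis θ)
  rw [Complex.real_smul]
  linear_combination (-T * Complex.I) * this

/-- The arcs `θ ↦ T γ(e^{iθ})` and `θ ↦ γ(T e^{iθ})` carry asymptotically the same flux. -/
theorem tendsto_homotopy {f : ℂ → ℝ} {s : ℂ} (hs : s.re = 1 / 2)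
    (hf : IsBoundedEigenfunction f s) {Ψ : ℂ → ℂ} (hΨ : IsC1NearCircle Ψ) (α β : ℝ) :
    Tendsto (fun T : ℝ => (∫ θ in α..β, fluxForm f s Ψ (γ.map (T * cis θ))
        (1 / γ.den (T * cis θ) ^ 2 * (T * (Complex.I * cis θ)))) -
      ∫ θ in α..β, fluxForm f s Ψ (T * γ.map (cis θ))
        (T * (1 / γ.den (cis θ) ^ 2 * (Complex.I * cis θ)))) (𝓝[<] 1) (𝓝 0) := by
  obtain ⟨δ, hδ, K, hK0, hK⟩ := exists_homotopy_bound hs hf hΨ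
  set d := ‖γ.a‖ - ‖γ.b‖ with hd
  have hd0 : 0 < d := sub_pos.2 γ.norm_b_lt
  -- `1 / d²` is a Lipschitz constant of `γ` on the closed disk, as `|γ.den| ≥ d`; the `1` accounts
  -- for scaling `γ(e^{iθ})` by `T`.
  set C := 1 / d ^ 2 + 1 with hC
  have hC0 : 0 < C := by positivity
  -- Lower bound for the depth of `γ(T e^{iθ})` relative to `1 - T`, from `|γ.den| ≤ |a| + |b|`; the
  -- `2` passes from `1 - |z|²` to `1 - |z|`.
  set c := 1 / (2 * (‖γ.a‖ + ‖γ.b‖) ^ 2) with hc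
  have hab : 1 ≤ ‖γ.a‖ + ‖γ.b‖ := by linarith [γ.one_le_norm_a, norm_nonneg γ.b]
  have hc0 : 0 < c := by positivity
  have hc1 : c ≤ 1 := by
    rw [hc, div_le_one (by positivity)]
    nlinarith
  have hCc : C + 1 > 0 := by positivity
  refine squeeze_zero_norm' ?_ (tendsto_sqrt_one_sub
    (K * (C / √c) * (2 / d ^ 2 + 1) * (|β - α| + 2)))
  filter_upwards [Ioo_mem_nhdsLT (show max 0 (1 - δ / (C + 1)) < 1 from
    max_lt one_pos (by linarith [div_pos hδ hCc]))] with T hT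
  have hT0 : 0 < T := (le_max_left _ _).trans_lt hT.1
  have hT1 : T < 1 := hT.2
  have hTδ : (C + 1) * (1 - T) < δ := by
    have : 1 - T < δ / (C + 1) := by linarith [(le_max_right _ _).trans_lt hT.1]
    rwa [lt_div_iff₀ hCc, mul_comm] at this
  have hinv : ∀ z : ℂ, ‖z‖ ≤ 1 → ‖1 / γ.den z ^ 2‖ ≤ 1 / d ^ 2 := fun z hz => by
    rw [norm_div, norm_one, norm_pow]
    have := γ.le_norm_den hz
    gcongr
  have hcT : ∀ θ, ‖(T : ℂ) * cis θ‖ ≤ 1 := fun θ => by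
    rw [norm_ofReal_mul_cis hT0.le]
    exact hT1.le
  have hc1' : ∀ θ, ‖cis θ‖ ≤ 1 := fun θ => (norm_cis θ).le
  have hmap1 : ∀ θ, ‖γ.map (cis θ)‖ = 1 := fun θ => γ.norm_map_of_norm_eq_one (norm_cis θ)
  have hdiff : ∀ θ, ‖γ.map (T * cis θ) - T * γ.map (cis θ)‖ ≤ C * (1 - T) := fun θ => by
    have h1 : γ.map (T * cis θ) - T * γ.map (cis θ) =
        (γ.map (T * cis θ) - γ.map (cis θ)) + ((1 - T : ℝ) : ℂ) * γ.map (cis θ) := by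
      push_cast
      ring
    have h2 : ‖γ.map (T * cis θ) - γ.map (cis θ)‖ ≤ (1 - T) / d ^ 2 := by
      have h3 : (T : ℂ) * cis θ - cis θ = -(((1 - T : ℝ) : ℂ) * cis θ) := by push_cast; ring
      rw [γ.map_sub_map (γ.den_ne_zero (hcT θ)) (γ.den_ne_zero (hc1' θ)), h3, norm_div, norm_neg,
        norm_ofReal_mul_cis (by linarith), norm_mul, sq]
      have := γ.le_norm_den (hcT θ)
      have := γ.le_norm_den (hc1' θ)
      have : 0 ≤ 1 - T := by linarith
      gcongr
    rw [h1]
    refine (norm_add_le _ _).trans ?_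
    rw [norm_mul, hmap1, Complex.norm_real, Real.norm_of_nonneg (by linarith)]
    refine (add_le_add_left h2 _).trans (le_of_eq ?_)
    rw [hC]
    ring
  have hgap : ∀ θ, c * (1 - T) ≤ 1 - ‖γ.map (T * cis θ)‖ := fun θ => by
    have h1 := γ.one_sub_norm_map_sq (γ.den_ne_zero (hcT θ))
    rw [norm_ofReal_mul_cis hT0.le] at h1
    have h2 : (1 - T) / (‖γ.a‖ + ‖γ.b‖) ^ 2 ≤ 1 - ‖γ.map (T * cis θ)‖ ^ 2 := by
      rw [h1]
      have := γ.norm_den_le (hcT θ)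
      have := γ.norm_den_pos (hcT θ)
      have : 0 ≤ 1 - T := by linarith
      gcongr <;> nlinarith
    have h3 : c * (1 - T) = (1 - T) / (‖γ.a‖ + ‖γ.b‖) ^ 2 / 2 := by
      rw [hc]
      field_simp
    rw [h3]
    have h4 : 0 ≤ (1 - T) / (‖γ.a‖ + ‖γ.b‖) ^ 2 := div_nonneg (by linarith) (by positivity)
    nlinarith [norm_nonneg (γ.map (T * cis θ))]
  -- Straight-line homotopy. Its speed is at most `C (1 - T)` and its depth at least `c (1 - T)`, so
  -- the ratio of the speed to the root of the depth is at most `(C / √c) √(1 - T)`, which tends to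
  -- `0`.
  have h := hK
    (fun p => ((1 - p.1 : ℝ) : ℂ) * (T * γ.map (cis p.2)) + (p.1 : ℂ) * γ.map (T * cis p.2))
    (fun p => γ.map (T * cis p.2) - T * γ.map (cis p.2))
    (fun p => ((1 - p.1 : ℝ) : ℂ) * (T * (1 / γ.den (cis p.2) ^ 2 * (Complex.I * cis p.2))) +
      (p.1 : ℂ) * (1 / γ.den (T * cis p.2) ^ 2 * (T * (Complex.I * cis p.2))))
    0 1 α β (C / √c * √(1 - T)) (2 / d ^ 2) ?_ ?_ ?_ (by positivity) (by positivity) ?_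
  · simp only [sub_self, sub_zero, Complex.ofReal_zero, Complex.ofReal_one, zero_mul, one_mul,
      zero_add, add_zero, abs_one, mul_one] at h
    exact h.trans (le_of_eq (by ring))
  · have hofReal : ContDiff ℝ 2 fun x : ℝ => (x : ℂ) := Complex.ofRealCLM.contDiff
    have h1 : ContDiff ℝ 2 fun θ : ℝ => γ.map (cis θ) := by
      simpa using γ.contDiff_map_mul_cis (n := 2) zero_le_one le_rfl
    have h2 : ContDiff ℝ 2 fun θ : ℝ => γ.map (T * cis θ) := γ.contDiff_map_mul_cis hT0.le hT1.le
    exact ((hofReal.comp (contDiff_const.sub contDiff_fst)).mul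
      (contDiff_const.mul (h1.comp contDiff_snd))).add
      ((hofReal.comp contDiff_fst).mul (h2.comp contDiff_snd))
  · intro t θ
    have h1 : HasDerivAt (fun t : ℝ => ((1 - t : ℝ) : ℂ)) ((-1 : ℝ) : ℂ) t :=
      ((hasDerivAt_id t).const_sub 1).ofReal_comp
    have h2 : HasDerivAt (fun t : ℝ => (t : ℂ)) ((1 : ℝ) : ℂ) t := (hasDerivAt_id t).ofReal_comp
    refine ((h1.mul_const (T * γ.map (cis θ))).add
      (h2.mul_const (γ.map (T * cis θ)))).congr_deriv ?_
    push_cast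
    ring
  · intro t θ
    have h1 := γ.hasDerivAt_map_mul_cis zero_le_one le_rfl θ
    simp only [Complex.ofReal_one, one_mul] at h1
    exact ((h1.const_mul (T : ℂ)).const_mul ((1 - t : ℝ) : ℂ)).add
      ((γ.hasDerivAt_map_mul_cis hT0.le hT1.le θ).const_mul (t : ℂ))
  · rintro ⟨t, θ⟩ ⟨ht, -⟩
    rw [uIcc_of_le zero_le_one] at ht
    obtain ⟨ht0, ht1⟩ := ht
    simp only at ht0 ht1 ⊢
    have h1t : 0 ≤ 1 - t := by linarith
    have hup : ‖((1 - t : ℝ) : ℂ) * (T * γ.map (cis θ)) + (t : ℂ) * γ.map (T * cis θ)‖ ≤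
        1 - c * (1 - T) := by
      refine (norm_add_le _ _).trans ?_
      rw [norm_mul, norm_mul, norm_mul, hmap1, Complex.norm_real, Complex.norm_real,
        Complex.norm_real, Real.norm_of_nonneg h1t, Real.norm_of_nonneg hT0.le,
        Real.norm_of_nonneg ht0]
      have h2 := hgap θ
      have h3 : t * ‖γ.map (T * cis θ)‖ ≤ t * (1 - c * (1 - T)) := by gcongr; linarith
      have h4 : (1 - t) * (T * 1) ≤ (1 - t) * (1 - c * (1 - T)) := by
        gcongr
        nlinarith
      linarith
    have hcT' : 0 < c * (1 - T) := mul_pos hc0 (by linarith)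
    refine ⟨?_, by linarith, ?_, ?_⟩
    · have e : ((1 - t : ℝ) : ℂ) * (T * γ.map (cis θ)) + (t : ℂ) * γ.map (T * cis θ) =
          T * γ.map (cis θ) + t * (γ.map (T * cis θ) - T * γ.map (cis θ)) := by
        push_cast
        ring
      have h1 := norm_sub_le_norm_add ((T : ℂ) * γ.map (cis θ))
        (t * (γ.map (T * cis θ) - T * γ.map (cis θ)))
      rw [e]
      rw [norm_mul, norm_mul, hmap1, Complex.norm_real, Complex.norm_real,
        Real.norm_of_nonneg hT0.le, Real.norm_of_nonneg ht0, mul_one] at h1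
      have h2 : t * ‖γ.map (T * cis θ) - T * γ.map (cis θ)‖ ≤ 1 * (C * (1 - T)) := by
        have := hdiff θ
        gcongr
      linarith
    · refine (hdiff θ).trans ?_
      have h1 : √(c * (1 - T)) ≤ √(1 -
          ‖((1 - t : ℝ) : ℂ) * (T * γ.map (cis θ)) + (t : ℂ) * γ.map (T * cis θ)‖) :=
        Real.sqrt_le_sqrt (by linarith)
      have h2 : C * (1 - T) = C / √c * √(1 - T) * √(c * (1 - T)) := by
        have h3 : √(1 - T) * √(1 - T) = 1 - T := Real.mul_self_sqrt (by linarith)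
        have h4 : √c ≠ 0 := (Real.sqrt_pos.2 hc0).ne'
        rw [Real.sqrt_mul hc0.le]
        calc C * (1 - T) = C * (√(1 - T) * √(1 - T)) := by rw [h3]
          _ = _ := by field_simp
      rw [h2]
      gcongr
    · refine (norm_add_le _ _).trans ?_
      simp only [norm_mul, Complex.norm_real, Complex.norm_I, norm_cis, mul_one,
        Real.norm_of_nonneg h1t, Real.norm_of_nonneg ht0, Real.norm_of_nonneg hT0.le]
      have h1 := hinv _ (hc1' θ)
      have h2 := hinv _ (hcT θ)
      calc _ ≤ 1 * (1 * (1 / d ^ 2)) + 1 * (1 / d ^ 2 * 1) := by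
            gcongr
            linarith
        _ = _ := by ring

/-- Equivariance of the flux. -/
theorem tendsto_flux_sub {f : ℂ → ℝ} {s : ℂ} (hs : s.re = 1 / 2)
    (hf : IsBoundedEigenfunction f s) (hγ : ∀ z ∈ disk, f (γ.map z) = f z) {Ψ : ℂ → ℂ}
    (hΨ : IsC1NearCircle Ψ) (α β : ℝ) :
    Tendsto (fun T : ℝ => flux f s Ψ (γ.lift α) (γ.lift β) T -
      flux f s (γ.pullback s Ψ) α β T) (𝓝[<] 1) (𝓝 0) := by
  have hΨ' := γ.isC1NearCircle_pullback hΨ s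
  obtain ⟨C, hC0, hC⟩ := exists_eventually_norm_mass_le hs hf hΨ'
  set d := ‖γ.a‖ - ‖γ.b‖ with hd
  have hd0 : 0 < d := sub_pos.2 γ.norm_b_lt
  set e : ℝ → ℝ → ℂ := fun T θ => 2 * s *
    (((starRingEnd ℂ) γ.b * (T * (Complex.I * cis θ)) / γ.den (T * cis θ)).im : ℝ) *
      (γ.pullback s Ψ (T * cis θ) * (weight s (T * cis θ) * f (T * cis θ))) with he
  have herr : Tendsto (fun T : ℝ => ∫ θ in α..β, e T θ) (𝓝[<] 1) (𝓝 0) := by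
    refine squeeze_zero_norm' ?_ (tendsto_sqrt_one_sub
      (2 * ‖s‖ * (‖γ.b‖ / d) * C * |β - α|))
    filter_upwards [hC, Ioo_mem_nhdsLT one_pos] with T hT hT1
    refine (intervalIntegral.norm_integral_le_of_norm_le_const
      (C := 2 * ‖s‖ * (‖γ.b‖ / d) * (C * √(1 - T))) fun θ _ => ?_).trans (le_of_eq (by ring))
    have h1 : ‖((((starRingEnd ℂ) γ.b * (T * (Complex.I * cis θ)) /
        γ.den (T * cis θ)).im : ℝ) : ℂ)‖ ≤ ‖γ.b‖ / d := by
      rw [Complex.norm_real]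
      refine (Complex.abs_im_le_norm _).trans ?_
      rw [norm_div, norm_mul, norm_mul, norm_mul, norm_cis, Complex.norm_I, Complex.norm_real,
        RCLike.norm_conj, Real.norm_of_nonneg hT1.1.le, mul_one, mul_one]
      have := γ.le_norm_den (z := T * cis θ) (by
        rw [norm_ofReal_mul_cis hT1.1.le]; exact hT1.2.le)
      have h2 : ‖γ.b‖ * T ≤ ‖γ.b‖ := mul_le_of_le_one_right (norm_nonneg _) hT1.2.le
      gcongr
    rw [he]
    simp only
    rw [norm_mul, norm_mul, norm_mul, Complex.norm_two]
    gcongr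
    exact hT.2 θ
  -- The flux through `γ(T e^{iθ})` is the pulled-back flux plus the error `e`; the homotopy
  -- replaces that arc by the circular one.
  have key := (γ.tendsto_homotopy hs hf hΨ α β).neg.add herr
  rw [neg_zero, zero_add] at key
  refine key.congr' ?_
  filter_upwards [γ.flux_lift hf.contDiffOn s hΨ α β, hC, eventually_mul_cis_mem one_pos,
    eventually_continuous_fluxForm hf.contDiffOn s hΨ'] with T h1 h2 h3 h4
  have h5 : (∫ θ in α..β, fluxForm f s Ψ (γ.map (T * cis θ))
      (1 / γ.den (T * cis θ) ^ 2 * (T * (Complex.I * cis θ)))) =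
      flux f s (γ.pullback s Ψ) α β T + ∫ θ in α..β, e T θ := by
    have hcis := continuous_cis
    have hec : Continuous fun θ => e T θ := by
      refine (continuous_const.mul (Complex.continuous_ofReal.comp
        (Complex.continuous_im.comp ?_))).mul h2.1
      refine Continuous.div (by fun_prop) (by unfold den; fun_prop) fun θ => γ.den_ne_zero ?_
      rw [norm_ofReal_mul_cis h3.1.le]
      exact h3.2.1.le
    rw [flux, ← intervalIntegral.integral_add (h4.intervalIntegrable _ _)
      (hec.intervalIntegrable _ _)]
    exact intervalIntegral.integral_congr fun θ _ =>
      γ.fluxForm_map hf.contDiffOn hγ s Ψ (h3.2.2 θ).2 _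
  rw [h1, h5]
  ring

end DiskMobius

/-! ### Convergence and equality of the pairings -/

theorem IsC1Extension.isC1NearCircle {I : Set ℂ} {ψ Ψ : ℂ → ℂ} (h : IsC1Extension I ψ Ψ) :
    IsC1NearCircle Ψ := h.2

/-- The value of the pairing, from the limit of the flux. -/
theorem tendsto_arcIntegral {f : ℂ → ℝ} {s : ℂ} (hs : s.re = 1 / 2)
    (hf : IsBoundedEigenfunction f s) {I : Set ℂ} {α β : ℝ} (h : IsArc I α β) {Ψ : ℂ → ℂ}
    (hΨ : IsC1NearCircle Ψ) {L : ℂ} (hL : Tendsto (flux f s Ψ α β) (𝓝[<] 1) (𝓝 L)) :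
    Tendsto (arcIntegral f s I Ψ) atTop
      (𝓝 (1 / normConst s * (Complex.exp (-(2 * s) * (Real.log 2 : ℝ)) * L))) := by
  rw [funext (arcIntegral_eq h f s Ψ)]
  exact (tendsto_integral_arcIntegrand hs hf hΨ hL).const_mul _

/-- The limit of the flux is the same for all extensions of a test function on an arc. -/
theorem tendsto_flux_of_eqOn {f : ℂ → ℝ} {s : ℂ} (hs : s.re = 1 / 2)
    (hf : IsBoundedEigenfunction f s) {I : Set ℂ} {α β : ℝ} (h : IsArc I α β) {Ψ Ψ' : ℂ → ℂ}
    (hΨ : IsC1NearCircle Ψ) (hΨ' : IsC1NearCircle Ψ') (heq : EqOn Ψ' Ψ I) {L : ℂ}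
    (hL : Tendsto (flux f s Ψ α β) (𝓝[<] 1) (𝓝 L)) :
    Tendsto (flux f s Ψ' α β) (𝓝[<] 1) (𝓝 L) := by
  have hsub : IsC1NearCircle fun z => Ψ' z - Ψ z := by
    obtain ⟨U, hU, hcU, hU'⟩ := hΨ
    obtain ⟨V, hV, hcV, hV'⟩ := hΨ'
    exact ⟨U ∩ V, hU.inter hV, subset_inter hcU hcV,
      (hV'.mono inter_subset_right).sub (hU'.mono inter_subset_left)⟩
  have h0 := tendsto_flux_zero hs hf hsub h.le fun θ hθ =>
    sub_eq_zero.2 (heq (h.image_subset ⟨θ, hθ, rfl⟩))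
  have key := h0.add hL
  rw [zero_add] at key
  refine key.congr' ?_
  filter_upwards [eventually_continuous_fluxForm hf.contDiffOn s hsub,
    eventually_continuous_fluxForm hf.contDiffOn s hΨ] with T h1 h2
  rw [flux, flux, flux, ← intervalIntegral.integral_add (h1.intervalIntegrable _ _)
    (h2.intervalIntegrable _ _)]
  refine intervalIntegral.integral_congr fun θ _ => ?_
  simp only [fluxForm, smul_apply, smul_eq_mul]
  ring

/-- Equivariance of the pairing of the Helgason distribution with piecewise `C¹` functions. -/
theorem exists_hasPairing_image (s : ℂ) (hs : s.re = 1 / 2)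
    (f : ℂ → ℝ) (hf : IsBoundedEigenfunction f s)
    (γ : DiskMobius) (hγ : ∀ z ∈ disk, f (γ.map z) = f z)
    (I : Set ℂ) (hI : I ⊆ circle) (hIconn : IsPreconnected I)
    (ψ : ℂ → ℂ) (hψ : IsC1OnClosure I ψ) :
    ∃ L : ℂ,
      HasPairing f s (γ.map '' I)
        (fun ξ => ψ (γ.inv.map ξ) / ((‖deriv γ.map (γ.inv.map ξ)‖ : ℝ) : ℂ) ^ s) L ∧
      HasPairing f s I ψ L := by
  obtain ⟨α, β, harc⟩ := exists_isArc hI hIconn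
  obtain ⟨Ψ, hΨ, hΨeq⟩ := harc.exists_isC1NearCircle hψ
  obtain ⟨L, hL⟩ := exists_tendsto_flux hs hf hΨ α β
  have hnorm : ∀ z ∈ I, ‖z‖ = 1 := fun z hz => by simpa [circle] using hI hz
  have hden : ∀ z ∈ I, γ.den z ≠ 0 := fun z hz => γ.den_ne_zero (hnorm z hz).le
  have harc' := γ.isArc_image harc
  -- The exponential is `2^(-2s)`, the limit of `(1 + T)^(-2s)`; `L` is the limit flux of one fixed
  -- extension on `I`.
  refine ⟨1 / normConst s * (Complex.exp (-(2 * s) * (Real.log 2 : ℝ)) * L),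
    ⟨⟨fun ξ => Ψ (γ.inv.map ξ) / γ.factor s (γ.inv.map ξ), ?_, ?_⟩, fun Ψ' hΨ' => ?_⟩,
    ⟨⟨Ψ, hΨeq, hΨ⟩, fun Ψ' hΨ' => ?_⟩⟩
  · rintro _ ⟨z, hz, rfl⟩
    simp only [γ.inv_map_map (hden z hz), γ.norm_deriv_map_cpow (hden z hz), hΨeq hz]
  · obtain ⟨U, hU, hcU, hΨU⟩ := hΨ
    refine isC1NearCircle_of_contDiffAt fun z hz => ?_
    have hz1 : ‖z‖ = 1 := by simpa [circle] using hz
    have hm := γ.inv.norm_map_of_norm_eq_one hz1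
    have hinv : ContDiffAt ℝ 1 γ.inv.map z := γ.inv.contDiffAt_map (γ.inv.den_ne_zero hz1.le)
    exact ((hΨU.contDiffAt (hU.mem_nhds (hcU (by simpa [circle] using hm)))).comp z hinv).mul
      (((γ.contDiffAt_factor (γ.den_ne_zero hm.le) s).comp z hinv).inv (γ.factor_ne_zero s _))
  -- Pulling an arbitrary extension back from `γ(I)` undoes the division by `|γ'|^s`, giving another
  -- extension of `ψ` from `I`.
  · have hpull : EqOn (γ.pullback s Ψ') Ψ I := fun z hz => by
      have h := hΨ'.1 ⟨z, hz, rfl⟩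
      simp only [γ.inv_map_map (hden z hz), γ.norm_deriv_map_cpow (hden z hz)] at h
      change Ψ' (γ.map z) * γ.factor s z = _
      rw [h, div_mul_cancel₀ _ (γ.factor_ne_zero s z), hΨeq hz]
    have h1 := tendsto_flux_of_eqOn hs hf harc hΨ
      (γ.isC1NearCircle_pullback hΨ'.isC1NearCircle s) hpull hL
    have h2 := (γ.tendsto_flux_sub hs hf hγ hΨ'.isC1NearCircle α β).add h1
    simp only [sub_add_cancel, zero_add] at h2
    exact tendsto_arcIntegral hs hf harc' hΨ'.isC1NearCircle h2
  · exact tendsto_arcIntegral hs hf harc hΨ'.isC1NearCircle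
      (tendsto_flux_of_eqOn hs hf harc hΨ hΨ'.isC1NearCircle (hΨ'.1.trans hΨeq.symm) hL)

end Helgason

theorem proposition2p3 (s : ℂ) (hs : s.re = 1 / 2)
    (f : ℂ → ℝ) (hf : Helgason.IsBoundedEigenfunction f s)
    (γ : Helgason.DiskMobius) (hγ : ∀ z ∈ Helgason.disk, f (γ.map z) = f z)
    (I : Set ℂ) (hI : I ⊆ Helgason.circle) (hIconn : IsPreconnected I)
    (ψ : ℂ → ℂ) (hψ : Helgason.IsC1OnClosure I ψ) :
    ∃ L : ℂ,
      Helgason.HasPairing f s (γ.map '' I)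
        (fun ξ => ψ (γ.inv.map ξ) / ((‖deriv γ.map (γ.inv.map ξ)‖ : ℝ) : ℂ) ^ s) L ∧
      Helgason.HasPairing f s I ψ L :=
  Helgason.exists_hasPairing_image s hs f hf γ hγ I hI hIconn ψ hψ
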